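/- For $d>2$ let $\mathcal M_d$ be the set of pairs $(f,c)$, where $f\in\mathbb C[z]$ has degree $d$ and $f'(c)=0$ ($c$ is the marked critical point), modulo affine conjugation: $(f,c)\sim(g,c')$ if there is $h(z)=az+b$, $a\neq 0$, with $g=h\circ f\circ h^{-1}$ and $h(c)=c'$. To $(\alpha_1,\dots,\alpha_{d-2},\beta)\in\mathbb C^{d-1}$ assign the class of $(f,\alpha_1)$, where $\alpha_{d-1}:=-(\alpha_1+\dots+\alpha_{d-2})$ and $$f(z)=z^d+\sum_{i=2}^{d-1}(-1)^i\tfrac{d}{d-i}\,s_i\,z^{d-i}-\alpha_1^d-\sum_{i=2}^{d-1}(-1)^i\tfrac{d}{d-i}\,s_i\,\alpha_1^{d-i}+\beta,$$ with $s_i$ the $i$-th elementary symmetric function of $\alpha_1,\dots,\alpha_{d-1}$; this $f$ has critical points $\alpha_1,\dots,\alpha_{d-1}$ and $f(\alpha_1)=\beta$. This map $\mathbb C^{d-1}\to\mathcal M_d$ identifies $\mathcal M_d$ with the quotient of $\mathbb C^{d-1}$ by a finite group, an affine variety, and $\mathcal M_d$ carries its Zariski topology (a set is closed iff its inverse image in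 $\mathbb C^{d-1}$ is Zariski closed). A point $x$ is strictly $(k,n)$-preperiodic under $f$ if $f^{k+n}(x)=f^k(x)$ and $f^{l+m}(x)\ne f^l(x)$ for all $0\le l\le k$, $1\le m\le n$ with $(l,m)\neq(k,n)$. Let $\Sigma_{k,n,d}\subset\mathcal M_d$ be the set of classes whose marked critical point is strictly $(k,n)$-preperiodic. The ramification index of $(f,c)$ is the multiplicity of $c$ as a root of $f(z)-f(c)$. **Theorem.** Let $p>3$ be prime, $k\ge 0$ and $2\le j\le p-2$. Let $V_j\subset\mathcal M_p$ be the set of points represented by some $(\alpha_1,\dots,\alpha_{p-2},\beta)\in\mathbb C^{p-1}$ with $\alpha_1=\alpha_2=\dots=\alpha_j$, and let $\Sigma_j:=\Sigma_{k,1,p}\cap V_j$. Then $\Sigma_j$ is the set of points of $\Sigma_{k,1,p}$ of ramification index at least $j+1$, it is a quasi-affine algebraic (that is, locally closed) subset of $\mathcal M_p$, and it is irreducible (in particular non-empty). -/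

import Mathlib

open Polynomial

namespace MarkedCritical

noncomputable section

/-- A complex polynomial of degree `d` with a marked (finite) critical point. -/
structure MarkedPoly (d : ℕ) where
  poly : ℂ[X]
  point : ℂ
  natDegree_eq : poly.natDegree = d
  critical : poly.derivative.eval point = 0

/-- Affine conjugacy of marked polynomials: there is `h(z) = a z + b` with `a ≠ 0` such that
`g ∘ h = h ∘ f` (that is, `g = h ∘ f ∘ h⁻¹`), and `h` sends the marked critical point of `f` to
the marked critical point of `g`. -/
def AffineConj {d : ℕ} (f g : MarkedPoly d) : Prop :=
  ∃ a b : ℂ, a ≠ 0 ∧ g.poly.comp (C a * X + C b) = (C a * X + C b).comp f.poly ∧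
    a * f.point + b = g.point

theorem affineConj_refl {d : ℕ} (f : MarkedPoly d) : AffineConj f f :=
  ⟨1, 0, one_ne_zero, by simp, by simp⟩

theorem affineConj_symm {d : ℕ} {f g : MarkedPoly d} (h : AffineConj f g) : AffineConj g f := by
  obtain ⟨a, b, ha, h1, h2⟩ := h
  refine ⟨a⁻¹, -(a⁻¹ * b), inv_ne_zero ha, ?_, ?_⟩
  · apply Polynomial.funext
    intro z
    have := congrArg (Polynomial.eval (a⁻¹ * z + -(a⁻¹ * b))) h1
    simp only [eval_comp, eval_add, eval_mul, eval_C, eval_X] at this ⊢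
    have e : a * (a⁻¹ * z + -(a⁻¹ * b)) + b = z := by field_simp; ring
    rw [e] at this
    rw [this]
    field_simp
    ring
  · rw [← h2]
    field_simp
    ring

theorem affineConj_trans {d : ℕ} {f g k : MarkedPoly d} (h : AffineConj f g)
    (h' : AffineConj g k) : AffineConj f k := by
  obtain ⟨a, b, ha, h1, h2⟩ := h
  obtain ⟨a', b', ha', h1', h2'⟩ := h'
  refine ⟨a' * a, a' * b + b', mul_ne_zero ha' ha, ?_, ?_⟩
  · apply Polynomial.funext
    intro z
    have e1 := congrArg (Polynomial.eval z) h1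
    have e2 := congrArg (Polynomial.eval (a * z + b)) h1'
    simp only [eval_comp, eval_add, eval_mul, eval_C, eval_X] at e1 e2 ⊢
    have e : a' * a * z + (a' * b + b') = a' * (a * z + b) + b' := by ring
    rw [e, e2, e1]
    ring
  · rw [← h2', ← h2]
    ring

instance affineSetoid (d : ℕ) : Setoid (MarkedPoly d) where
  r := AffineConj
  iseqv := ⟨affineConj_refl, affineConj_symm, affineConj_trans⟩

/-- The moduli space of degree `d` polynomials with a marked critical point, modulo affine
conjugation. -/
def ModuliSpace (d : ℕ) : Type := Quotient (affineSetoid d)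

/-- The class of a marked polynomial. -/
def ModuliSpace.mk {d : ℕ} (f : MarkedPoly d) : ModuliSpace d := Quotient.mk (affineSetoid d) f

/-- The affine space `ℂ^{d-1}` with coordinates `α₁, …, α_{d-2}, β`. The coordinate `α_{i+1}` is
the value at `some i`, and `β` is the value at `none`. -/
abbrev Coord (d : ℕ) : Type := Option (Fin (d - 2)) → ℂ

/-- The marked critical point `α₁`. -/
def Coord.alphaOne {d : ℕ} (hd : 2 < d) (x : Coord d) : ℂ := x (some ⟨0, by omega⟩)

/-- The critical points `α₁, …, α_{d-2}, α_{d-1}`, where `α_{d-1} = -(α₁ + ⋯ + α_{d-2})`; the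
critical point `α_{i+1}` has index `i`. -/
def Coord.alpha {d : ℕ} (x : Coord d) (i : Fin (d - 1)) : ℂ :=
  if h : (i : ℕ) < d - 2 then x (some ⟨i, h⟩) else -∑ l : Fin (d - 2), x (some l)

/-- The elementary symmetric function `s_i(α₁, …, α_{d-1})`. -/
def Coord.s {d : ℕ} (x : Coord d) (i : ℕ) : ℂ :=
  (Finset.univ.val.map x.alpha : Multiset ℂ).esymm i

/-- The part `z^d + ∑_{i=2}^{d-1} (-1)^i (d/(d-i)) s_i(α) z^{d-i}` of the normal form. -/
def Coord.monicPart {d : ℕ} (x : Coord d) : ℂ[X] :=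
  X ^ d + ∑ i ∈ Finset.Icc 2 (d - 1),
    C ((-1) ^ i * ((d : ℂ) / ((d - i : ℕ) : ℂ)) * x.s i) * X ^ (d - i)

/-- The monic reduced polynomial with critical points `α₁, …, α_{d-1}` and `f(α₁) = β`:
`z^d + ∑ (-1)^i (d/(d-i)) s_i(α) z^{d-i} - α₁^d - ∑ (-1)^i (d/(d-i)) s_i(α) α₁^{d-i} + β`. -/
def Coord.normalForm {d : ℕ} (hd : 2 < d) (x : Coord d) : ℂ[X] :=
  x.monicPart - C (x.monicPart.eval (x.alphaOne hd)) + C (x none)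

theorem Coord.sum_alpha {d : ℕ} (hd : 2 < d) (x : Coord d) : ∑ i, x.alpha i = 0 := by
  obtain ⟨n, rfl⟩ : ∃ n, d = n + 3 := ⟨d - 3, by omega⟩
  change ∑ i : Fin (n + 1 + 1), x.alpha i = 0
  rw [Fin.sum_univ_castSucc]
  have h1 : ∀ i : Fin (n + 1), x.alpha (Fin.castSucc i) = x (some i) := fun i =>
    dif_pos (show ((Fin.castSucc i : Fin (n + 2)) : ℕ) < n + 3 - 2 from i.2)
  have h2 : x.alpha (Fin.last (n + 1)) = -∑ l : Fin (n + 1), x (some l) :=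
    dif_neg (show ¬ ((Fin.last (n + 1) : Fin (n + 2)) : ℕ) < n + 3 - 2 by
      simp only [Fin.val_last]; omega)
  rw [h2]
  simp only [h1]
  ring

theorem Coord.derivative_normalForm {d : ℕ} (hd : 2 < d) (x : Coord d) :
    (x.normalForm hd).derivative = C (d : ℂ) * ∏ i, (X - C (x.alpha i)) := by
  have hv := Multiset.prod_X_sub_X_eq_sum_esymm (Finset.univ.val.map x.alpha : Multiset ℂ)
  have hprod : ((Finset.univ.val.map x.alpha : Multiset ℂ).map fun t => X - C t).prod
      = ∏ i, (X - C (x.alpha i)) := by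
    rw [Multiset.map_map]; rfl
  rw [hprod] at hv
  have hc : Multiset.card (Finset.univ.val.map x.alpha : Multiset ℂ) = d - 1 := by simp
  rw [hc] at hv
  have hs1 : (Finset.univ.val.map x.alpha : Multiset ℂ).esymm 1 = 0 := by
    have h : (Finset.univ.val.map x.alpha : Multiset ℂ).sum = 0 := x.sum_alpha hd
    rw [Multiset.esymm, Multiset.powersetCard_one, Multiset.map_map]
    simpa only [Function.comp_def, Multiset.prod_singleton, Multiset.map_id'] using h
  have hs0 : (Finset.univ.val.map x.alpha : Multiset ℂ).esymm 0 = 1 := by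
    simp [Multiset.esymm]
  have hr : Finset.range (d - 1 + 1) = insert 0 (insert 1 (Finset.Icc 2 (d - 1))) := by
    ext i; simp only [Finset.mem_range, Finset.mem_insert, Finset.mem_Icc]; omega
  have hv' : ∏ i, (X - C (x.alpha i)) = X ^ (d - 1) + ∑ i ∈ Finset.Icc 2 (d - 1),
      (-1) ^ i * (C ((Finset.univ.val.map x.alpha : Multiset ℂ).esymm i) * X ^ (d - 1 - i)) := by
    rw [hv, hr, Finset.sum_insert (by simp), Finset.sum_insert (by simp), hs0, hs1]
    simp only [Nat.sub_zero, pow_zero, map_one, one_mul, map_zero, zero_mul, mul_zero, zero_add]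
  rw [hv', mul_add, Finset.mul_sum]
  simp only [Coord.normalForm, Coord.monicPart, derivative_add, derivative_sub, derivative_C,
    derivative_sum, derivative_C_mul, derivative_X_pow, sub_zero, add_zero]
  refine congrArg (fun t => C (d : ℂ) * X ^ (d - 1) + t) (Finset.sum_congr rfl fun i hi => ?_)
  rw [Finset.mem_Icc] at hi
  have hne : ((d - i : ℕ) : ℂ) ≠ 0 := by
    rw [Nat.cast_ne_zero]; omega
  have e : d - i - 1 = d - 1 - i := by omega
  rw [e]
  have h1 : ((-1 : ℂ[X]) ^ i) = C ((-1 : ℂ) ^ i) := by simp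
  rw [h1, ← mul_assoc, ← mul_assoc, ← mul_assoc, ← C_mul, ← C_mul, ← C_mul]
  congr 2
  simp only [Coord.s]
  field_simp

theorem Coord.natDegree_normalForm {d : ℕ} (hd : 2 < d) (x : Coord d) :
    (x.normalForm hd).natDegree = d := by
  have hsum : (∑ i ∈ Finset.Icc 2 (d - 1),
      C ((-1) ^ i * ((d : ℂ) / ((d - i : ℕ) : ℂ)) * x.s i) * X ^ (d - i) : ℂ[X]).degree < (d : WithBot ℕ) := by
    rw [← mem_degreeLT]
    refine Submodule.sum_mem _ ?_
    intro i hi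
    rw [Finset.mem_Icc] at hi
    rw [mem_degreeLT]
    refine lt_of_le_of_lt (degree_C_mul_X_pow_le _ _) ?_
    exact_mod_cast (by omega : d - i < d)
  have hm : x.monicPart.degree = (d : WithBot ℕ) := by
    unfold Coord.monicPart
    rw [degree_add_eq_left_of_degree_lt (by rwa [degree_X_pow]), degree_X_pow]
  have hd' : x.monicPart.natDegree = d := natDegree_eq_of_degree_eq_some hm
  rw [Coord.normalForm, natDegree_add_C, natDegree_sub_C, hd']

/-- The marked polynomial with coordinates `(α₁, …, α_{d-2}, β)`: its polynomial is in normal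
form, and its marked critical point is `α₁`. -/
def Coord.markedPoly {d : ℕ} (hd : 2 < d) (x : Coord d) : MarkedPoly d where
  poly := x.normalForm hd
  point := x.alphaOne hd
  natDegree_eq := x.natDegree_normalForm hd
  critical := by
    rw [x.derivative_normalForm hd, eval_mul, eval_prod,
      Finset.prod_eq_zero (Finset.mem_univ (⟨0, by omega⟩ : Fin (d - 1))), mul_zero]
    have h : 0 < d - 2 := by omega
    simp [Coord.alpha, Coord.alphaOne, h]

/-- The map from `ℂ^{d-1}` onto the moduli space. -/
def Coord.toModuli {d : ℕ} (hd : 2 < d) (x : Coord d) : ModuliSpace d :=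
  ModuliSpace.mk (x.markedPoly hd)

/-- The Zariski topology on the affine space `ℂ^σ`: the closed sets are the common zero sets of
families of polynomials. -/
@[reducible] def zariskiAffine (σ : Type) : TopologicalSpace (σ → ℂ) :=
  TopologicalSpace.ofClosed
    {Z | ∃ S : Set (MvPolynomial σ ℂ), Z = {x | ∀ P ∈ S, MvPolynomial.eval x P = 0}}
    ⟨{1}, by ext x; simp⟩
    (by
      intro A hA
      refine ⟨{P | ∃ Z ∈ A, ∀ x ∈ Z, MvPolynomial.eval x P = 0}, ?_⟩
      ext x
      simp only [Set.mem_sInter, Set.mem_ofPred_eq]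
      constructor
      · rintro h P ⟨Z, hZ, hP⟩
        exact hP x (h Z hZ)
      · intro h Z hZ
        obtain ⟨S, rfl⟩ := hA hZ
        intro P hP
        exact h P ⟨_, hZ, fun y hy => hy P hP⟩)
    (by
      rintro A ⟨S, rfl⟩ B ⟨T, rfl⟩
      refine ⟨{R | ∃ P ∈ S, ∃ Q ∈ T, R = P * Q}, ?_⟩
      ext x
      simp only [Set.mem_union, Set.mem_ofPred_eq]
      constructor
      · rintro (h | h) R ⟨P, hP, Q, hQ, rfl⟩
        · simp [h P hP]
        · simp [h Q hQ]
      · intro h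
        by_contra hcon
        push Not at hcon
        obtain ⟨⟨P, hP, hPx⟩, Q, hQ, hQx⟩ := hcon
        have := h _ ⟨P, hP, Q, hQ, rfl⟩
        rw [map_mul] at this
        exact (mul_ne_zero hPx hQx) this)

/-- The Zariski topology on the moduli space. Two points of `ℂ^{d-1}` have the same image in the
moduli space exactly when they are related by the action of a finite group (permutations of
`α₂, …, α_{d-1}` and multiplication of all coordinates by a `(d-1)`-th root of unity), and the
moduli space is the affine variety `ℂ^{d-1}/G`. As for every quotient of an affine variety by a
finite group, its closed sets are the sets whose inverse image in `ℂ^{d-1}` is closed. -/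
@[reducible] def zariskiModuli {d : ℕ} (hd : 2 < d) : TopologicalSpace (ModuliSpace d) :=
  TopologicalSpace.coinduced (Coord.toModuli hd) (zariskiAffine (Option (Fin (d - 2))))

/-- `x` is strictly `(k,n)`-preperiodic under `g`. -/
def IsStrictlyPreperiodic (g : ℂ → ℂ) (k n : ℕ) (x : ℂ) : Prop :=
  g^[k + n] x = g^[k] x ∧
    ∀ l m : ℕ, l ≤ k → 1 ≤ m → m ≤ n → (l, m) ≠ (k, n) → g^[l + m] x ≠ g^[l] x

/-- `Σ_{k,n,d}`: the classes whose marked critical point is strictly `(k,n)`-preperiodic. -/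
def preperiodicLocus (k n d : ℕ) : Set (ModuliSpace d) :=
  {c | ∃ f : MarkedPoly d, ModuliSpace.mk f = c ∧
    IsStrictlyPreperiodic (fun z => f.poly.eval z) k n f.point}

/-- `V_j`: the classes that are represented by a point `(α₁, …, α_{d-2}, β)` with
`α₁ = α₂ = ⋯ = α_j`. -/
def equalCriticalLocus {d : ℕ} (hd : 2 < d) (j : ℕ) : Set (ModuliSpace d) :=
  {c | ∃ x : Coord d, x.toModuli hd = c ∧
    ∀ i : Fin (d - 2), (i : ℕ) < j → x (some i) = x.alphaOne hd}

/-- The ramification index of the marked critical point: the multiplicity of `point` as a root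
of `f(z) - f(point)`. -/
def MarkedPoly.ramificationIndex {d : ℕ} (f : MarkedPoly d) : ℕ :=
  (f.poly - C (f.poly.eval f.point)).rootMultiplicity f.point

/-- The classes whose marked critical point has ramification index at least `r`. -/
def ramificationLocus (d r : ℕ) : Set (ModuliSpace d) :=
  {c | ∃ f : MarkedPoly d, ModuliSpace.mk f = c ∧ r ≤ f.ramificationIndex}

end

end MarkedCritical

namespace MarkedCritical

noncomputable section

/-! Put m = p - 1 - j ≥ 1. A marked polynomial of ramification index at least j + 1 is conjugate to
f(z) = z^(j+1) h(z) + b marked at 0, where h is determined by the m remaining critical points γ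
(`exists_centeredMarkedPoly`). Its critical orbit is b u_n with u_n the `reducedOrbit`, and u_{k+2}
- u_{k+1} = b^j (u_{k+1} - u_k) Φ_k with Φ_k the `coincidence` polynomial. So strict
(k+1,1)-preperiodicity means Φ_k = 0 and b (u_{k+1} - u_k) ≠ 0, while strict (0,1)-preperiodicity
means b = 0. The locus is thus the image, under a polynomial map, of a principal open subset of a
hypersurface in (γ, b)-space. It is irreducible once Φ_k is irreducible and that open subset is
non-empty.

Both facts are p-adic. The coefficients of h below the leading one are p/(j+1+i) times those of ∏(z
- γ_i), so for integral γ the map f reduces to z^p + b modulo p, and Frobenius gives Φ_k ≡ b^N with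
N = deg Φ_k. On the line γ = (t, 1, …, 1) the constant coefficient of Φ_k is a nonzero complex
number times t. If Φ_k = A B with monic factors and t divides A(0), then B(0) is a nonzero number β
independent of t. At t = 1 the polynomial Φ_k has Eisenstein shape, so v(β)^N = v(p)^(deg B). If deg
A and deg B are positive, then N ≥ 2 and at t = 0 the same holds for Φ_k / b, so v(β)^(N-1) =
v(p)^(deg B). Hence v(β) = 1, which forces deg B = 0, a contradiction
(`irreducible_coincidence_line`). Since Φ_k is monic in b, irreducibility lifts from the line to all
γ. The same estimates give a point of the open subset (`exists_nondegenerate_root`).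

Local closedness is separate: coincidences in the orbit and lower bounds on ramification are
polynomial conditions on the coordinates, invariant under conjugacy. -/

/-- The critical orbit of `z ↦ z ^ (j + 1) * h z + b`, divided by `b`, as polynomials in `b`. -/
def reducedOrbit {R : Type*} [CommRing R] (j : ℕ) (h : R[X]) : ℕ → R[X]
  | 0 => 0
  | n + 1 => 1 + X ^ j * reducedOrbit j h n ^ (j + 1) * h.comp (X * reducedOrbit j h n)

/-- The polynomial in `b` whose zeros are the parameters for which the point `k + 1` of the critical
orbit of `z ↦ z ^ (j + 1) * h z + b` has the same image as
the point `k`, with the trivial solution that the two points agree divided out. -/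
def coincidence {R : Type*} [CommRing R] (j m : ℕ) (h : R[X]) (k : ℕ) : R[X] :=
  ∑ i ∈ Finset.range (m + 1), C (h.coeff i) * X ^ i *
    ∑ l ∈ Finset.range (j + i + 1), reducedOrbit j h (k + 1) ^ l * reducedOrbit j h k ^ (j + i - l)

/-! ### The critical orbit as a polynomial in b: factorization, degrees, reduction modulo p. -/

section Algebra

variable {R S : Type*} [CommRing R] [CommRing S]

theorem map_reducedOrbit (φ : R →+* S) (j : ℕ) (h : R[X]) (n : ℕ) :
    (reducedOrbit j h n).map φ = reducedOrbit j (h.map φ) n := by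
  induction n with
  | zero => simp [reducedOrbit]
  | succ n ih => simp [reducedOrbit, ih, Polynomial.map_comp]

theorem map_coincidence (φ : R →+* S) (j m : ℕ) (h : R[X]) (k : ℕ) :
    (coincidence j m h k).map φ = coincidence j m (h.map φ) k := by
  simp [coincidence, Polynomial.map_sum, map_reducedOrbit]

/-- Subtracting two instances of the recursion leaves terms h_i X^(j+i) (u^(j+1+i) - w^(j+1+i)), and
each power difference is u - w times a geometric sum. -/
theorem reducedOrbit_sub_mul_coincidence {j m : ℕ} {h : R[X]} (hm : h.natDegree ≤ m) (k : ℕ) :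
    X ^ j * (reducedOrbit j h (k + 1) - reducedOrbit j h k) * coincidence j m h k =
      reducedOrbit j h (k + 2) - reducedOrbit j h (k + 1) := by
  have hcomp : ∀ y : R[X], h.comp y = ∑ i ∈ Finset.range (m + 1), C (h.coeff i) * y ^ i := fun y =>
    eval₂_eq_sum_range' _ (Nat.lt_succ_of_le hm) _
  rw [reducedOrbit.eq_2 j h (k + 1)]
  nth_rewrite 4 [reducedOrbit.eq_2 j h k]
  set u := reducedOrbit j h (k + 1) with hu
  set w := reducedOrbit j h k with hw
  rw [hcomp, hcomp, coincidence, Finset.mul_sum, Finset.mul_sum, Finset.mul_sum,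
    add_sub_add_left_eq_sub, ← Finset.sum_sub_distrib, ← hu, ← hw]
  refine Finset.sum_congr rfl fun i _ => ?_
  have hg := (Commute.all u w).mul_geom_sum₂ (j + i + 1)
  simp only [Nat.add_sub_cancel] at hg
  calc _ = X ^ j * C (h.coeff i) * X ^ i * ((u - w) *
      ∑ l ∈ Finset.range (j + i + 1), u ^ l * w ^ (j + i - l)) := by ring
    _ = _ := by rw [hg]; ring

theorem reducedOrbit_one (j : ℕ) (h : R[X]) : reducedOrbit j h 1 = 1 := by
  simp [reducedOrbit]

/-- The orbit point itself is `X` times the reduced one and has degree (j + m + 1)^n, whence the `+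
1`. -/
theorem monic_reducedOrbit_succ [Nontrivial R] {j m : ℕ} {h : R[X]} (hj : 1 ≤ j) (hh : h.Monic)
    (hm : h.natDegree = m) (n : ℕ) : (reducedOrbit j h (n + 1)).Monic ∧
      (reducedOrbit j h (n + 1)).natDegree + 1 = (j + m + 1) ^ n := by
  induction n with
  | zero => simp [reducedOrbit_one]
  | succ n ih =>
    obtain ⟨hu, hd⟩ := ih
    rw [reducedOrbit.eq_2 j h (n + 1)]
    set u := reducedOrbit j h (n + 1)
    have hy : (X * u).Monic := monic_X.mul hu
    have hyd : (X * u).natDegree = u.natDegree + 1 := by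
      rw [monic_X.natDegree_mul hu, natDegree_X]; ring
    have hc : (h.comp (X * u)).Monic := hh.comp hy (by omega)
    have hcd : (h.comp (X * u)).natDegree = m * (u.natDegree + 1) := by
      rw [natDegree_comp_eq_of_mul_ne_zero (by simp [hh, hy]), hm, hyd]
    have hX : (X ^ j * u ^ (j + 1) : R[X]).Monic := (monic_X_pow j).mul (hu.pow _)
    have hM := hX.mul hc
    have hMd : (X ^ j * u ^ (j + 1) * h.comp (X * u)).natDegree + 1 = (j + m + 1) ^ (n + 1) := by
      rw [hX.natDegree_mul hc, (monic_X_pow j).natDegree_mul (hu.pow _), hu.natDegree_pow, hcd,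
        natDegree_X_pow, pow_succ, ← hd]
      ring
    -- Here j ≥ 1 is essential: the factor `X ^ j` makes the product dominate the summand 1.
    have hlt : (1 : R[X]).natDegree < (X ^ j * u ^ (j + 1) * h.comp (X * u)).natDegree := by
      rw [natDegree_one, hX.natDegree_mul hc, (monic_X_pow j).natDegree_mul (hu.pow _),
        natDegree_X_pow]
      omega
    refine ⟨hM.add_of_right (degree_lt_degree hlt), ?_⟩
    rw [natDegree_add_eq_right_of_natDegree_lt hlt, hMd]

theorem monic_reducedOrbit_sub [Nontrivial R] {j m : ℕ} {h : R[X]} (hj : 1 ≤ j) (hh : h.Monic)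
    (hm : h.natDegree = m) (n : ℕ) : (reducedOrbit j h (n + 1) - reducedOrbit j h n).Monic ∧
      (reducedOrbit j h (n + 1) - reducedOrbit j h n).natDegree + 1 = (j + m + 1) ^ n := by
  obtain ⟨h1, h2⟩ := monic_reducedOrbit_succ hj hh hm n
  cases n with
  | zero => simp [reducedOrbit]
  | succ n =>
    obtain ⟨h3, h4⟩ := monic_reducedOrbit_succ hj hh hm n
    have hlt : (reducedOrbit j h (n + 1)).natDegree < (reducedOrbit j h (n + 1 + 1)).natDegree := by
      have : (j + m + 1) ^ n < (j + m + 1) ^ (n + 1) := Nat.pow_lt_pow_right (by omega) (by omega)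
      omega
    refine ⟨h1.sub_of_left (degree_lt_degree hlt), ?_⟩
    rw [natDegree_sub_eq_left_of_natDegree_lt hlt, h2]

/-- Monicity and degree are read off from the factorization of consecutive differences, whose other
factors are monic of known degree. -/
theorem monic_coincidence [Nontrivial R] {j m : ℕ} {h : R[X]} (hj : 1 ≤ j) (hh : h.Monic)
    (hm : h.natDegree = m) (k : ℕ) : (coincidence j m h k).Monic ∧
      (coincidence j m h k).natDegree = (j + m) * ((j + m + 1) ^ k - 1) + m := by
  have key := reducedOrbit_sub_mul_coincidence hm.le (j := j) k
  obtain ⟨h1, h2⟩ := monic_reducedOrbit_sub hj hh hm k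
  obtain ⟨h3, h4⟩ := monic_reducedOrbit_sub hj hh hm (k + 1)
  have hl := (monic_X_pow j).mul h1
  rw [← key] at h3 h4
  have hM := hl.of_mul_monic_left h3
  refine ⟨hM, ?_⟩
  rw [hl.natDegree_mul hM, (monic_X_pow j).natDegree_mul h1, natDegree_X_pow] at h4
  rw [pow_succ, ← h2] at h4
  rw [← h2, Nat.add_sub_cancel]
  nlinarith

/-- This is the map z^p + b in characteristic p: additivity of Frobenius turns the recursion into
d_{n+1} = X^(p-1) d_n^p for the differences d_n. -/
theorem reducedOrbit_X_pow_sub (p : ℕ) [Fact p.Prime] [CharP R p] {j m : ℕ} (hp : p = j + m + 1)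
    (n : ℕ) : reducedOrbit j (X ^ m : R[X]) (n + 1) - reducedOrbit j (X ^ m) n =
      X ^ (p ^ n - 1) := by
  have hrec : ∀ n, reducedOrbit j (X ^ m : R[X]) (n + 1) =
      1 + X ^ (p - 1) * reducedOrbit j (X ^ m) n ^ p := fun n => by
    rw [reducedOrbit, X_pow_comp, hp, Nat.add_sub_cancel]
    ring
  induction n with
  | zero => simp [reducedOrbit]
  | succ n ih =>
    rw [hrec (n + 1)]
    nth_rewrite 2 [hrec n]
    rw [add_sub_add_left_eq_sub, ← mul_sub, ← sub_pow_char, ih, ← pow_mul, ← pow_add]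
    congr 1
    have : 1 ≤ p ^ n := Nat.one_le_pow _ _ (Fact.out : p.Prime).pos
    obtain ⟨c, hc⟩ := Nat.exists_eq_add_of_le this
    have : 1 ≤ p := (Fact.out : p.Prime).pos
    obtain ⟨q, hq⟩ := Nat.exists_eq_add_of_le this
    rw [pow_succ, hc, hq]
    simp only [Nat.add_sub_cancel_left]
    rw [show (1 + c) * (1 + q) = 1 + (q + c * (1 + q)) by ring, Nat.add_sub_cancel_left]

theorem coincidence_X_pow [Nontrivial R] (p : ℕ) [Fact p.Prime] [CharP R p] {j m : ℕ}
    (hp : p = j + m + 1) (k : ℕ) :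
    coincidence j m (X ^ m : R[X]) k = X ^ ((j + m) * ((j + m + 1) ^ k - 1) + m) := by
  have key := reducedOrbit_sub_mul_coincidence (j := j) (natDegree_X_pow_le (R := R) m) k
  rw [reducedOrbit_X_pow_sub p hp, reducedOrbit_X_pow_sub p hp, ← pow_add] at key
  -- The ring may have zero divisors, since O/pO is the intended case; powers of `X` can still be
  -- cancelled.
  refine (monic_X_pow (R := R) (j + (p ^ k - 1))).isRegular.left ?_
  simp only []
  rw [key, ← pow_add]
  congr 1
  have : 1 ≤ p ^ k := Nat.one_le_pow _ _ (Fact.out : p.Prime).pos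
  obtain ⟨c, hc⟩ := Nat.exists_eq_add_of_le this
  rw [← hp, pow_succ, hc, Nat.add_sub_cancel_left]
  nth_rewrite 1 [hp]
  rw [show (1 + c) * (j + m + 1) = 1 + (j + c + ((j + m) * c + m)) by ring, Nat.add_sub_cancel_left]

theorem eval_zero_reducedOrbit_succ {j : ℕ} (hj : 1 ≤ j) (h : R[X]) (n : ℕ) :
    (reducedOrbit j h (n + 1)).eval 0 = 1 := by
  simp [reducedOrbit, show j ≠ 0 by omega]

/-- At b = 0 all reduced orbit points are 1 except the initial one, which is 0. For k = 0 only the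
last summand survives, with exponent 0. -/
theorem eval_zero_geom {j : ℕ} (hj : 1 ≤ j) (h : R[X]) (k i : ℕ) :
    eval 0 (∑ l ∈ Finset.range (i + 1), reducedOrbit j h (k + 1) ^ l * reducedOrbit j h k ^ (i - l))
      = if k = 0 then 1 else (i + 1 : R) := by
  rw [eval_finsetSum]
  simp only [eval_mul, eval_pow, eval_zero_reducedOrbit_succ hj, one_pow, one_mul]
  cases k with
  | zero =>
    rw [Finset.sum_range_succ, Finset.sum_eq_zero]
    · simp [reducedOrbit]
    · intro l hl
      have := Finset.mem_range.1 hl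
      simp [reducedOrbit, show i - l ≠ 0 by omega]
  | succ k => simp [eval_zero_reducedOrbit_succ hj]

theorem coeff_zero_coincidence {j : ℕ} (hj : 1 ≤ j) (m : ℕ) (h : R[X]) (k : ℕ) :
    (coincidence j m h k).coeff 0 = h.coeff 0 * if k = 0 then 1 else (j + 1 : R) := by
  rw [coeff_zero_eq_eval_zero, coincidence, eval_finsetSum, Finset.sum_eq_single 0]
  · rw [eval_mul, eval_zero_geom hj h k (j + 0)]
    simp
  · intro i _ hi
    simp [hi]
  · simp

theorem coeff_one_coincidence {j m : ℕ} (hj : 1 ≤ j) (hm : 1 ≤ m) {h : R[X]} (h0 : h.coeff 0 = 0)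
    (k : ℕ) :
    (coincidence j m h k).coeff 1 = h.coeff 1 * if k = 0 then 1 else (j + 2 : R) := by
  rw [coincidence, finsetSum_coeff, Finset.sum_eq_single 1]
  · rw [pow_one, mul_assoc, coeff_C_mul, coeff_X_mul, coeff_zero_eq_eval_zero,
      eval_zero_geom hj h k (j + 1)]
    push_cast
    congr 2
    ring
  · intro i _ hi
    rcases Nat.eq_zero_or_pos i with rfl | hpos
    · simp [h0]
    · rw [mul_assoc, coeff_C_mul, coeff_X_pow_mul', if_neg (by omega), mul_zero]
  · intro hcon
    simp at hcon
    omega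

end Algebra

/-! ### Valuations above p and roots of Eisenstein-type polynomials. -/

section Valuations

/-- The ideal generated by p in the image of ℤ is proper, so some valuation ring of K contains that
image with this ideal among its nonunits. -/
theorem exists_valuationSubring_natCast_lt_one {K : Type*} [Field K] [CharZero K] {p : ℕ}
    (hp : p.Prime) : ∃ O : ValuationSubring K, O.valuation (p : K) < 1 := by
  let A : Subring K := (Int.castRingHom K).range
  let I : Ideal A := Ideal.span {(p : A)}
  have hI : I ≠ ⊤ := by
    intro h
    rw [Ideal.span_singleton_eq_top, isUnit_iff_exists_inv] at h
    obtain ⟨⟨_, ⟨b, rfl⟩⟩, hb⟩ := h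
    have h1 := congrArg Subtype.val hb
    have h2 : ((p * b : ℤ) : K) = ((1 : ℤ) : K) := by simpa using h1
    have h3 : (p : ℤ) * b = 1 := Int.cast_injective h2
    have h4 : (p : ℤ) ∣ 1 := ⟨b, h3.symm⟩
    have := Int.natCast_dvd_natCast.1 (by exact_mod_cast h4 : (p : ℤ) ∣ ((1 : ℕ) : ℤ))
    exact hp.one_lt.ne' (Nat.dvd_one.1 this)
  obtain ⟨O, _, hO⟩ := I.image_subset_nonunits_valuationSubring hI
  refine ⟨O, ?_⟩
  rw [← ValuationSubring.mem_nonunits_iff]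
  exact hO ⟨(p : A), Ideal.subset_span rfl, by simp⟩

variable {K : Type*} [Field K] (O : ValuationSubring K)

theorem valuation_intCast_le_one (n : ℤ) : O.valuation (n : K) ≤ 1 :=
  (O.valuation_le_one_iff _).2 (intCast_mem O n)

theorem valuation_natCast_eq_one {p : ℕ} (hp : p.Prime) (hv : O.valuation (p : K) < 1) {q : ℕ}
    (hq : 0 < q) (hqp : q < p) : O.valuation (q : K) = 1 := by
  refine le_antisymm (by exact_mod_cast valuation_intCast_le_one O q) (not_lt.1 fun hlt => ?_)
  have hc : IsCoprime (q : ℤ) (p : ℤ) := Nat.isCoprime_iff_coprime.2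
    ((Nat.coprime_of_lt_prime hq.ne' hqp hp).symm)
  obtain ⟨a, b, hab⟩ := hc
  have h1 : (a : K) * q + b * p = 1 := by exact_mod_cast congrArg (Int.cast : ℤ → K) hab
  have h2 : O.valuation ((a : K) * q + b * p) < 1 := by
    refine Valuation.map_add_lt _ ?_ ?_
    · rw [map_mul]
      exact (mul_le_of_le_one_left zero_le (valuation_intCast_le_one O a)).trans_lt hlt
    · rw [map_mul]
      exact (mul_le_of_le_one_left zero_le (valuation_intCast_le_one O b)).trans_lt hv
  rw [h1, map_one] at h2
  exact lt_irrefl _ h2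

variable {Γ : Type*} [LinearOrderedCommGroupWithZero Γ] (v : Valuation K Γ)

/-- The roots of an "Eisenstein" polynomial of degree `M` with constant term of the valuation of `π`
all have valuation `v π ^ (1 / M)`. -/
theorem valuation_root_pow {π : K} (hπ : π ≠ 0) (hπ1 : v π < 1) {Q : K[X]} (hQ : Q.Monic)
    {M : ℕ} (hM : Q.natDegree = M) (hM0 : 1 ≤ M) (hle : ∀ i < M, v (Q.coeff i) ≤ v π)
    (h0 : v (Q.coeff 0) = v π) {ρ : K} (hρ : Q.eval ρ = 0) : v ρ ^ M = v π := by
  have hvπ : v π ≠ 0 := (v.ne_zero_iff).2 hπ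
  have hsum : ρ ^ M = -∑ i ∈ Finset.range M, Q.coeff i * ρ ^ i := by
    rw [eval_eq_sum_range, hM, Finset.sum_range_succ] at hρ
    have : Q.coeff M = 1 := by rw [← hM]; exact hQ
    rw [this, one_mul] at hρ
    exact eq_neg_of_add_eq_zero_right hρ
  -- If v ρ ≥ 1, the leading term would strictly dominate all the others.
  have hlt : v ρ < 1 := by
    by_contra hge
    rw [not_lt] at hge
    have hne : v ρ ^ M ≠ 0 := pow_ne_zero _ (ne_of_gt (lt_of_lt_of_le zero_lt_one hge))
    have : v (∑ i ∈ Finset.range M, Q.coeff i * ρ ^ i) < v ρ ^ M := by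
      refine v.map_sum_lt hne fun i hi => ?_
      have hi := Finset.mem_range.1 hi
      rw [map_mul, map_pow]
      calc _ ≤ v π * v ρ ^ M := mul_le_mul' (hle i hi) (pow_le_pow_right₀ hge hi.le)
        _ < v ρ ^ M := mul_lt_of_lt_one_left (zero_lt_iff.2 hne) hπ1
    rw [← v.map_neg, ← hsum, map_pow] at this
    exact lt_irrefl _ this
  rw [← map_pow, hsum, v.map_neg]
  obtain ⟨L, rfl⟩ := Nat.exists_eq_add_of_le' hM0
  -- Now that v ρ < 1, the constant term strictly dominates the other lower terms.
  rw [Finset.sum_range_succ', pow_zero, mul_one, add_comm, Valuation.map_add_eq_of_lt_left, h0]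
  rw [h0]
  refine v.map_sum_lt hvπ fun i hi => ?_
  have hi := Finset.mem_range.1 hi
  rw [map_mul, map_pow]
  calc _ ≤ v π * v ρ ^ (i + 1) := mul_le_mul_left (hle _ (by omega)) _
    _ < v π := mul_lt_of_lt_one_right (zero_lt_iff.2 hvπ)
      (pow_lt_one₀ zero_le hlt (Nat.succ_ne_zero _))

/-- By Vieta the constant term is, up to sign, the product of the roots. -/
theorem valuation_coeff_zero_pow [IsAlgClosed K] {a : Γ} {M : ℕ} {B : K[X]} (hB : B.Monic)
    (h : ∀ ρ, B.eval ρ = 0 → v ρ ^ M = a) : v (B.coeff 0) ^ M = a ^ B.natDegree := by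
  have hs : B.Splits := IsAlgClosed.splits B
  rw [hs.coeff_zero_eq_prod_roots_of_monic hB, map_mul, map_pow, v.map_neg, map_one, one_pow,
    one_mul, map_multiset_prod, ← Multiset.prod_map_pow]
  rw [hs.natDegree_eq_card_roots, ← Multiset.prod_replicate]
  congr 1
  rw [Multiset.eq_replicate]
  refine ⟨by simp, fun b hb => ?_⟩
  obtain ⟨ρ, hρ, rfl⟩ := Multiset.mem_map.1 hb
  exact h ρ (isRoot_of_mem_roots hρ)

end Valuations

/-! ### Congruences modulo p for the orbit and the coincidence polynomial. -/

section Reduction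

variable {K : Type*} [Field K] [CharZero K] (O : ValuationSubring K)

/-- If `h` is monic and congruent to `X ^ m` modulo `p = j + m + 1`, then both the differences of
the reduced orbit and the coincidence polynomial are congruent to powers of `X` modulo `p`. -/
theorem valuation_coeff_sub_X_pow_le {p j m : ℕ} (hp : p.Prime) (hpj : p = j + m + 1)
    (hv : O.valuation (p : K) < 1) {h : K[X]} (hh : h.Monic) (hm : h.natDegree = m)
    (hle : ∀ i < m, O.valuation (h.coeff i) ≤ O.valuation (p : K)) (k i : ℕ) :
    O.valuation ((reducedOrbit j h (k + 1) - reducedOrbit j h k - X ^ (p ^ k - 1)).coeff i) ≤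
      O.valuation (p : K) ∧
    O.valuation ((coincidence j m h k - X ^ ((j + m) * ((j + m + 1) ^ k - 1) + m)).coeff i) ≤
      O.valuation (p : K) := by
  have hp0 : (p : K) ≠ 0 := Nat.cast_ne_zero.2 hp.ne_zero
  have hvp : O.valuation (p : K) ≠ 0 := (O.valuation.ne_zero_iff).2 hp0
  have hq : ∀ i < m, h.coeff i / p ∈ O := fun i hi => by
    rw [← O.valuation_le_one_iff, map_div₀]
    exact div_le_one_of_le₀ (hle i hi) zero_le
  choose! q hqO using fun i (hi : i < m) => (⟨⟨_, hq i hi⟩, rfl⟩ : ∃ q : O, (q : K) = h.coeff i / p)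
  -- A lift of h to O whose lower coefficients are visibly multiples of p.
  let h' : O[X] := X ^ m + ∑ i ∈ Finset.range m, C ((p : O) * q i) * X ^ i
  have hmap : h'.map O.subtype = h := by
    conv_rhs => rw [hh.as_sum, hm]
    simp only [h', Polynomial.map_add, Polynomial.map_sum, Polynomial.map_mul, Polynomial.map_pow,
      map_X, map_C]
    congr 1
    refine Finset.sum_congr rfl fun i hi => ?_
    rw [map_mul, map_natCast]
    change C ((p : K) * (q i : K)) * X ^ i = _
    rw [hqO i (Finset.mem_range.1 hi), mul_div_cancel₀ _ hp0]
  have : Fact p.Prime := ⟨hp⟩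
  have hnon : (p : O) ∈ nonunits O := by
    have h1 := (O.valuation_lt_one_iff (p : O)).2 (by simpa using hv)
    exact (IsLocalRing.mem_maximalIdeal _).1 h1
  -- Reducing modulo pO rather than the maximal ideal gives the sharp bound v(p), not merely a bound
  -- below 1.
  let I : Ideal O := Ideal.span {(p : O)}
  have : CharP (O ⧸ I) p := CharP.quotient O p hnon
  have : Nontrivial (O ⧸ I) := CharP.nontrivial_of_char_ne_one hp.ne_one
  let φ := Ideal.Quotient.mk I
  have hφ : h'.map φ = X ^ m := by
    simp only [h', Polynomial.map_add, Polynomial.map_sum, Polynomial.map_mul, Polynomial.map_pow,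
      map_X, map_C]
    rw [Finset.sum_eq_zero, add_zero]
    intro i _
    rw [map_mul, map_natCast, CharP.cast_eq_zero, zero_mul, C_0, zero_mul]
  have key : ∀ F : O[X], F.map φ = 0 → ∀ i, O.valuation ((F.map O.subtype).coeff i) ≤
      O.valuation (p : K) := by
    intro F hF i
    have h1 := congrArg (fun G => G.coeff i) hF
    simp only [coeff_map, coeff_zero] at h1
    obtain ⟨c, hc⟩ := Ideal.mem_span_singleton.1 (Ideal.Quotient.eq_zero_iff_mem.1 h1)
    rw [coeff_map, hc, map_mul, map_natCast, map_mul]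
    exact mul_le_of_le_one_right zero_le (O.valuation_le_one c)
  constructor
  · have := key (reducedOrbit j h' (k + 1) - reducedOrbit j h' k - X ^ (p ^ k - 1)) (by
      rw [Polynomial.map_sub, Polynomial.map_sub, map_reducedOrbit, map_reducedOrbit, hφ,
        reducedOrbit_X_pow_sub p hpj, Polynomial.map_pow, map_X, sub_self]) i
    rwa [Polynomial.map_sub, Polynomial.map_sub, map_reducedOrbit, map_reducedOrbit, hmap,
      Polynomial.map_pow, map_X] at this
  · have := key (coincidence j m h' k - X ^ ((j + m) * ((j + m + 1) ^ k - 1) + m)) (by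
      rw [Polynomial.map_sub, map_coincidence, hφ,
        coincidence_X_pow p hpj, Polynomial.map_pow, map_X, sub_self]) i
    rwa [Polynomial.map_sub, map_coincidence, hmap, Polynomial.map_pow, map_X] at this

end Reduction

/-! ### Recovering a polynomial from its critical points. -/

section Cofactor

variable {R S : Type*} [CommRing R] [CommRing S] [Algebra ℂ R] [Algebra ℂ S]

/-- The polynomial `h` such that `X ^ (j + 1) * h` has derivative `(j + m + 1) * X ^ j * P`, for `P`
of degree at most `m`. -/
def cofactor (j m : ℕ) (P : R[X]) : R[X] :=
  ∑ i ∈ Finset.range (m + 1),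
    C (algebraMap ℂ R (((j + m + 1 : ℕ) : ℂ) / ((j + 1 + i : ℕ) : ℂ)) * P.coeff i) * X ^ i

theorem map_cofactor (φ : R →ₐ[ℂ] S) (j m : ℕ) (P : R[X]) :
    (cofactor j m P).map (φ : R →+* S) = cofactor j m (P.map (φ : R →+* S)) := by
  simp [cofactor, Polynomial.map_sum]

theorem coeff_cofactor (j : ℕ) {m : ℕ} (P : R[X]) {i : ℕ} (hi : i ≤ m) :
    (cofactor j m P).coeff i =
      algebraMap ℂ R (((j + m + 1 : ℕ) : ℂ) / ((j + 1 + i : ℕ) : ℂ)) * P.coeff i := by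
  rw [cofactor, finsetSum_coeff, Finset.sum_eq_single i]
  · rw [coeff_C_mul_X_pow, if_pos rfl]
  · intro l _ hl
    rw [coeff_C_mul_X_pow, if_neg hl.symm]
  · intro hcon
    exact absurd (Finset.mem_range.2 (Nat.lt_succ_of_le hi)) hcon

theorem natDegree_cofactor_le (j m : ℕ) (P : R[X]) : (cofactor j m P).natDegree ≤ m :=
  natDegree_sum_le_of_forall_le _ _ fun _ hi =>
    (natDegree_C_mul_X_pow_le _ _).trans (Nat.lt_succ_iff.1 (Finset.mem_range.1 hi))

theorem coeff_cofactor_top (j : ℕ) {m : ℕ} {P : R[X]} (hP : P.Monic) (hm : P.natDegree = m) :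
    (cofactor j m P).coeff m = 1 := by
  rw [coeff_cofactor j P le_rfl]
  have h1 : P.coeff m = 1 := by rw [← hm]; exact hP
  rw [h1, show j + 1 + m = j + m + 1 by ring, div_self (Nat.cast_ne_zero.2 (by omega)), map_one,
    one_mul]

theorem monic_cofactor (j : ℕ) {m : ℕ} {P : R[X]} (hP : P.Monic) (hm : P.natDegree = m) :
    (cofactor j m P).Monic :=
  monic_of_natDegree_le_of_coeff_eq_one m (natDegree_cofactor_le _ _ _) (coeff_cofactor_top j hP hm)

theorem natDegree_cofactor [Nontrivial R] (j : ℕ) {m : ℕ} {P : R[X]} (hP : P.Monic)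
    (hm : P.natDegree = m) : (cofactor j m P).natDegree = m :=
  natDegree_eq_of_le_of_coeff_ne_zero (natDegree_cofactor_le _ _ _)
    (by rw [coeff_cofactor_top j hP hm]; exact one_ne_zero)

theorem derivative_X_pow_mul_cofactor (j : ℕ) {m : ℕ} {P : R[X]} (hm : P.natDegree ≤ m) :
    (X ^ (j + 1) * cofactor j m P).derivative = C ((j + m + 1 : ℕ) : R) * (X ^ j * P) := by
  conv_rhs => rw [P.as_sum_range_C_mul_X_pow' (Nat.lt_succ_of_le hm)]
  rw [cofactor, Finset.mul_sum, derivative_sum, Finset.mul_sum, Finset.mul_sum]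
  refine Finset.sum_congr rfl fun i _ => ?_
  rw [show X ^ (j + 1) * (C (algebraMap ℂ R (((j + m + 1 : ℕ) : ℂ) / ((j + 1 + i : ℕ) : ℂ)) *
      P.coeff i) * X ^ i) = C (algebraMap ℂ R (((j + m + 1 : ℕ) : ℂ) / ((j + 1 + i : ℕ) : ℂ)) *
      P.coeff i) * X ^ (j + 1 + i) by ring, derivative_C_mul_X_pow]
  have h1 : ((j + 1 + i : ℕ) : R) = algebraMap ℂ R ((j + 1 + i : ℕ) : ℂ) := by simp
  rw [h1, mul_right_comm, ← map_mul, div_mul_cancel₀ _ (Nat.cast_ne_zero.2 (by omega)),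
    map_natCast, C_mul, show j + 1 + i - 1 = j + i by omega]
  ring

end Cofactor

/-! ### Irreducibility of the coincidence polynomial. -/

section Irreducibility

variable (O : ValuationSubring ℂ) {p j m : ℕ}

theorem valuation_div_natCast (hp : p.Prime) (hv : O.valuation (p : ℂ) < 1) {q : ℕ} (hq : 0 < q)
    (hqp : q < p) : O.valuation ((p : ℂ) / (q : ℂ)) = O.valuation (p : ℂ) := by
  rw [map_div₀, valuation_natCast_eq_one O hp hv hq hqp, div_one]

theorem valuation_coeff_cofactor_le (hp : p.Prime) (hpj : p = j + m + 1)
    (hv : O.valuation (p : ℂ) < 1) (P : ℤ[X]) {i : ℕ} (hi : i < m) :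
    O.valuation ((cofactor j m (P.map (Int.castRingHom ℂ))).coeff i) ≤ O.valuation (p : ℂ) := by
  rw [coeff_cofactor j _ hi.le, ← hpj, map_mul, Algebra.algebraMap_self_apply,
    valuation_div_natCast O hp hv (by omega) (by omega), coeff_map]
  exact mul_le_of_le_one_right zero_le (valuation_intCast_le_one O _)

/-- The degree of the coincidence polynomial as a polynomial in `b`. -/
abbrev coincidenceDegree (j m k : ℕ) : ℕ := (j + m) * ((j + m + 1) ^ k - 1) + m

theorem valuation_neg_one_pow (n : ℕ) : O.valuation ((-1 : ℂ) ^ n) = 1 := by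
  rw [map_pow, Valuation.map_neg, map_one, one_pow]

theorem valuation_root_of_all_one (hp : p.Prime) (hpj : p = j + m + 1)
    (hj : 1 ≤ j) (hm : 1 ≤ m) (hv : O.valuation (p : ℂ) < 1) (k : ℕ) {ρ : ℂ}
    (hρ : (coincidence j m (cofactor j m ((X - C 1) ^ m)) k).eval ρ = 0) :
    O.valuation ρ ^ coincidenceDegree j m k = O.valuation (p : ℂ) := by
  have hPm : ((X - C 1 : ℂ[X]) ^ m).Monic := (monic_X_sub_C 1).pow m
  have hPd : ((X - C 1 : ℂ[X]) ^ m).natDegree = m := by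
    rw [(monic_X_sub_C 1).natDegree_pow, natDegree_X_sub_C, mul_one]
  have hh := monic_cofactor j hPm hPd
  have hd := natDegree_cofactor j hPm hPd
  obtain ⟨hQ, hQd⟩ := monic_coincidence hj hh hd k
  have hle : ∀ i < m, O.valuation ((cofactor j m ((X - C 1 : ℂ[X]) ^ m)).coeff i) ≤
      O.valuation (p : ℂ) := fun i hi => by
    have hP : ((X - C 1 : ℤ[X]) ^ m).map (Int.castRingHom ℂ) = (X - C 1) ^ m := by simp
    rw [← hP]
    exact valuation_coeff_cofactor_le O hp hpj hv _ hi
  refine valuation_root_pow O.valuation (Nat.cast_ne_zero.2 hp.ne_zero) hv hQ hQd (by omega)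
    (fun i hi => ?_) ?_ hρ
  · have := (valuation_coeff_sub_X_pow_le O hp hpj hv hh hd hle k i).2
    rwa [coeff_sub, coeff_X_pow, if_neg hi.ne, sub_zero] at this
  · rw [coeff_zero_coincidence hj, coeff_cofactor j _ (Nat.zero_le m), ← hpj,
      Algebra.algebraMap_self_apply, coeff_zero_eq_eval_zero, map_mul, map_mul,
      valuation_div_natCast O hp hv (by omega) (by omega)]
    have h1 : O.valuation (eval 0 ((X - C 1 : ℂ[X]) ^ m)) = 1 := by
      rw [eval_pow, eval_sub, eval_X, eval_C, zero_sub, valuation_neg_one_pow]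
    have h2 : O.valuation (if k = 0 then (1 : ℂ) else j + 1) = 1 := by
      split_ifs
      · exact map_one _
      · have := valuation_natCast_eq_one O hp hv (q := j + 1) (by omega) (by omega)
        exact_mod_cast this
    rw [h1, h2, mul_one, mul_one]

/-- With one free critical point at 0 the constant term vanishes; after removing one factor `X` the
linear coefficient, again of valuation v(p), plays the Eisenstein role. -/
theorem valuation_root_of_one_zero {n : ℕ} (hp : p.Prime) (hpj : p = j + (n + 1) + 1)
    (hj : 1 ≤ j) (hv : O.valuation (p : ℂ) < 1) (k : ℕ)
    (hN : 2 ≤ coincidenceDegree j (n + 1) k) :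
    ∃ Q : ℂ[X], coincidence j (n + 1) (cofactor j (n + 1) (X * (X - C 1) ^ n)) k = X * Q ∧
      ∀ ρ, Q.eval ρ = 0 →
        O.valuation ρ ^ (coincidenceDegree j (n + 1) k - 1) = O.valuation (p : ℂ) := by
  have hPm : (X * (X - C 1 : ℂ[X]) ^ n).Monic := monic_X.mul ((monic_X_sub_C 1).pow n)
  have hPd : (X * (X - C 1 : ℂ[X]) ^ n).natDegree = n + 1 := by
    rw [monic_X.natDegree_mul ((monic_X_sub_C 1).pow n), (monic_X_sub_C 1).natDegree_pow,
      natDegree_X_sub_C, mul_one, natDegree_X, add_comm]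
  have hh := monic_cofactor j hPm hPd
  have hd := natDegree_cofactor j hPm hPd
  obtain ⟨hQ, hQd⟩ := monic_coincidence hj hh hd k
  have hle : ∀ i < n + 1, O.valuation ((cofactor j (n + 1) (X * (X - C 1 : ℂ[X]) ^ n)).coeff i) ≤
      O.valuation (p : ℂ) := fun i hi => by
    have hP : (X * (X - C 1 : ℤ[X]) ^ n).map (Int.castRingHom ℂ) = X * (X - C 1) ^ n := by simp
    rw [← hP]
    exact valuation_coeff_cofactor_le O hp hpj hv _ hi
  have h0 : (cofactor j (n + 1) (X * (X - C 1 : ℂ[X]) ^ n)).coeff 0 = 0 := by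
    rw [coeff_cofactor j _ (Nat.zero_le _), coeff_X_mul_zero, mul_zero]
  set F := coincidence j (n + 1) (cofactor j (n + 1) (X * (X - C 1 : ℂ[X]) ^ n)) k with hF
  have hF0 : F.coeff 0 = 0 := by rw [hF, coeff_zero_coincidence hj, h0, zero_mul]
  have hdiv : F = X * F.divX := by
    conv_lhs => rw [← divX_mul_X_add F, hF0, C_0, add_zero, mul_comm]
  refine ⟨F.divX, hdiv, fun ρ hρ => ?_⟩
  have hQ' : F.divX.Monic := monic_X.of_mul_monic_left (hdiv ▸ hQ)
  refine valuation_root_pow O.valuation (Nat.cast_ne_zero.2 hp.ne_zero) hv hQ'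
    (by rw [natDegree_divX_eq_natDegree_tsub_one, hQd]) (by omega) (fun i hi => ?_) ?_ hρ
  · have := (valuation_coeff_sub_X_pow_le O hp hpj hv hh hd hle k (i + 1)).2
    rw [coeff_sub, coeff_X_pow, if_neg (by unfold coincidenceDegree at hi; omega), sub_zero] at this
    rwa [coeff_divX]
  · rw [coeff_divX, zero_add, hF, coeff_one_coincidence hj (by omega) h0,
      coeff_cofactor j _ (by omega : 1 ≤ n + 1), ← hpj, Algebra.algebraMap_self_apply,
      coeff_X_mul, coeff_zero_eq_eval_zero, eval_pow, eval_sub, eval_X, eval_C, zero_sub,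
      mul_right_comm, map_mul, valuation_neg_one_pow, mul_one]
    -- For k = 0 the bound on the degree gives n ≥ 1, so j + 2 < p is a unit. For k > 0 the factor j
    -- + 2 cancels the denominator of p/(j+2), which covers j + 2 = p too.
    split_ifs with hk
    · subst hk
      have : 2 ≤ n + 1 := by simpa [coincidenceDegree] using hN
      rw [mul_one, valuation_div_natCast O hp hv (by omega) (by omega)]
    · rw [show (j + 2 : ℂ) = ((j + 1 + 1 : ℕ) : ℂ) by push_cast; ring,
        div_mul_cancel₀ _ (Nat.cast_ne_zero.2 (by omega))]

/-- When all free critical points are `1`, some zero of the coincidence polynomial is not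
a degenerate coincidence of two earlier points of the critical orbit. -/
theorem exists_nondegenerate_root (hp : p.Prime) (hpj : p = j + m + 1) (hj : 1 ≤ j) (hm : 1 ≤ m)
    (k : ℕ) : ∃ b : ℂ, (coincidence j m (cofactor j m ((X - C 1 : ℂ[X]) ^ m)) k).eval b = 0 ∧ b ≠ 0 ∧
      (reducedOrbit j (cofactor j m ((X - C 1 : ℂ[X]) ^ m)) (k + 1) -
        reducedOrbit j (cofactor j m ((X - C 1 : ℂ[X]) ^ m)) k).eval b ≠ 0 := by
  obtain ⟨O, hv⟩ := exists_valuationSubring_natCast_lt_one (K := ℂ) hp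
  have hPm : ((X - C 1 : ℂ[X]) ^ m).Monic := (monic_X_sub_C 1).pow m
  have hPd : ((X - C 1 : ℂ[X]) ^ m).natDegree = m := by
    rw [(monic_X_sub_C 1).natDegree_pow, natDegree_X_sub_C, mul_one]
  have hh := monic_cofactor j hPm hPd
  have hd := natDegree_cofactor j hPm hPd
  obtain ⟨hQ, hQd⟩ := monic_coincidence hj hh hd k
  have hle : ∀ i < m, O.valuation ((cofactor j m ((X - C 1 : ℂ[X]) ^ m)).coeff i) ≤
      O.valuation (p : ℂ) := fun i hi => by
    have hP : ((X - C 1 : ℤ[X]) ^ m).map (Int.castRingHom ℂ) = (X - C 1) ^ m := by simp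
    rw [← hP]
    exact valuation_coeff_cofactor_le O hp hpj hv _ hi
  obtain ⟨b, hb⟩ := IsAlgClosed.exists_root (coincidence j m (cofactor j m ((X - C 1 : ℂ[X]) ^ m)) k)
    (natDegree_pos_iff_degree_pos.1 (by rw [hQd]; omega)).ne'
  have hvb := valuation_root_of_all_one O hp hpj hj hm hv k hb
  have hvp : O.valuation (p : ℂ) ≠ 0 :=
    (O.valuation.ne_zero_iff).2 (Nat.cast_ne_zero.2 hp.ne_zero)
  have hN0 : coincidenceDegree j m k ≠ 0 := by unfold coincidenceDegree; omega
  have hb0 : b ≠ 0 := by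
    rintro rfl
    rw [map_zero, zero_pow hN0] at hvb
    exact hvp hvb.symm
  have hvb0 : 0 < O.valuation b := zero_lt_iff.2 ((O.valuation.ne_zero_iff).2 hb0)
  have hvb1 : O.valuation b < 1 := by
    by_contra hge
    exact absurd (hvb ▸ one_le_pow₀ (not_lt.1 hge)) (not_le.2 hv)
  refine ⟨b, hb, hb0, fun hzero => ?_⟩
  set D := reducedOrbit j (cofactor j m ((X - C 1 : ℂ[X]) ^ m)) (k + 1) -
        reducedOrbit j (cofactor j m ((X - C 1 : ℂ[X]) ^ m)) k with hD
  -- Since D ≡ X^(p^k-1) modulo p, a zero of D at b would give v(b)^(p^k-1) ≤ v(p) = v(b)^N,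
  -- impossible because p^k - 1 < N and v(b) < 1.
  have hsmall : O.valuation ((D - X ^ (p ^ k - 1)).eval b) ≤ O.valuation (p : ℂ) := by
    rw [eval_eq_sum_range]
    refine Valuation.map_sum_le _ fun i _ => ?_
    rw [map_mul, map_pow]
    calc _ ≤ O.valuation (p : ℂ) * 1 :=
          mul_le_mul' (valuation_coeff_sub_X_pow_le O hp hpj hv hh hd hle k i).1
            (pow_le_one₀ zero_le hvb1.le)
      _ = _ := mul_one _
  rw [eval_sub, hzero, zero_sub, Valuation.map_neg, eval_pow, eval_X, map_pow, ← hvb] at hsmall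
  refine absurd hsmall (not_le.2 (pow_lt_pow_right_of_lt_one₀ hvb0 hvb1 ?_))
  rw [hpj]
  unfold coincidenceDegree
  nlinarith [Nat.zero_le ((j + m + 1) ^ k - 1)]

/-- Along the line where one of the free critical points is `t` and all others are `1`, the
coincidence polynomial is irreducible. -/
theorem irreducible_coincidence_line {n : ℕ} (hp : p.Prime) (hpj : p = j + (n + 1) + 1)
    (hj : 1 ≤ j) (k : ℕ) :
    Irreducible (coincidence j (n + 1)
      (cofactor j (n + 1) ((X - C X) * (X - C 1) ^ n : ℂ[X][X])) k) := by
  obtain ⟨O, hv⟩ := exists_valuationSubring_natCast_lt_one (K := ℂ) hp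
  have hPm : ((X - C X) * (X - C 1) ^ n : ℂ[X][X]).Monic :=
    (monic_X_sub_C _).mul ((monic_X_sub_C 1).pow n)
  have hPd : ((X - C X) * (X - C 1) ^ n : ℂ[X][X]).natDegree = n + 1 := by
    rw [(monic_X_sub_C _).natDegree_mul ((monic_X_sub_C 1).pow n), (monic_X_sub_C 1).natDegree_pow,
      natDegree_X_sub_C, natDegree_X_sub_C, mul_one, add_comm]
  have hh := monic_cofactor j hPm hPd
  have hd := natDegree_cofactor j hPm hPd
  obtain ⟨hQ, hQd⟩ := monic_coincidence hj hh hd k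
  have hmap : ∀ t : ℂ, (coincidence j (n + 1)
      (cofactor j (n + 1) ((X - C X) * (X - C 1) ^ n : ℂ[X][X])) k).map (evalRingHom t) =
      coincidence j (n + 1) (cofactor j (n + 1) ((X - C t) * (X - C 1) ^ n)) k := fun t => by
    have h := map_cofactor (Polynomial.aeval t : ℂ[X] →ₐ[ℂ] ℂ) j (n + 1)
      ((X - C X) * (X - C 1) ^ n : ℂ[X][X])
    have he : ((Polynomial.aeval t : ℂ[X] →ₐ[ℂ] ℂ) : ℂ[X] →+* ℂ) = evalRingHom t := by
      ext <;> simp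
    rw [he] at h
    rw [map_coincidence, h]
    simp
  have hc0 : ∃ c : ℂ, c ≠ 0 ∧ (coincidence j (n + 1)
      (cofactor j (n + 1) ((X - C X) * (X - C 1) ^ n : ℂ[X][X])) k).coeff 0 = C c * X := by
    refine ⟨((j + (n + 1) + 1 : ℕ) : ℂ) / ((j + 1 + 0 : ℕ) : ℂ) * ((-1) * (-1) ^ n) *
      (if k = 0 then (1 : ℂ) else (j : ℂ) + 1), ?_, ?_⟩
    · refine mul_ne_zero (mul_ne_zero (div_ne_zero ?_ ?_) ?_) ?_
      · exact Nat.cast_ne_zero.2 (by omega)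
      · exact Nat.cast_ne_zero.2 (by omega)
      · exact mul_ne_zero (by norm_num) (pow_ne_zero _ (by norm_num))
      · split_ifs
        · exact one_ne_zero
        · exact Nat.cast_add_one_ne_zero j
    · rw [coeff_zero_coincidence hj, coeff_cofactor j _ (Nat.zero_le _), coeff_zero_eq_eval_zero]
      simp only [eval_mul, eval_sub, eval_X, eval_C, eval_pow, zero_sub, algebraMap_eq]
      split_ifs <;> simp <;> ring
  set F := coincidence j (n + 1) (cofactor j (n + 1) ((X - C X) * (X - C 1) ^ n : ℂ[X][X])) k
  have hpos : 1 ≤ F.natDegree := by rw [hQd]; omega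
  have key : ∀ A B : ℂ[X][X], A.Monic → B.Monic → A * B = F → X ∣ A.coeff 0 → A.natDegree ≠ 0 →
      B.natDegree = 0 := by
    intro A B hA hB hAB hX hA0
    by_contra hB0
    have hN : 2 ≤ coincidenceDegree j (n + 1) k := by
      rw [← hAB, hA.natDegree_mul hB] at hQd
      unfold coincidenceDegree
      omega
    obtain ⟨c, hc, hcX⟩ := hc0
    obtain ⟨A', hA'⟩ := hX
    have hprod : A' * B.coeff 0 = C c := by
      rw [← hAB, mul_coeff_zero, hA', mul_assoc, mul_comm (C c)] at hcX
      exact mul_left_cancel₀ X_ne_zero hcX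
    -- A(0) B(0) is a nonzero number times t; as A(0) absorbs t, B(0) is a nonzero constant.
    have hunit : IsUnit (B.coeff 0) :=
      isUnit_of_mul_isUnit_right (hprod ▸ isUnit_C.2 (isUnit_iff_ne_zero.2 hc))
    obtain ⟨β, hβ, hβB⟩ := Polynomial.isUnit_iff.1 hunit
    have hvp : O.valuation (p : ℂ) ≠ 0 :=
      (O.valuation.ne_zero_iff).2 (Nat.cast_ne_zero.2 hp.ne_zero)
    have hcoeff : ∀ t : ℂ, (B.map (evalRingHom t)).coeff 0 = β := fun t => by
      rw [coeff_map, ← hβB]; simp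
    have hdeg : ∀ t : ℂ, (B.map (evalRingHom t)).natDegree = B.natDegree := fun t =>
      hB.natDegree_map _
    have h1 : O.valuation β ^ coincidenceDegree j (n + 1) k =
        O.valuation (p : ℂ) ^ B.natDegree := by
      rw [← hcoeff 1, ← hdeg 1]
      refine valuation_coeff_zero_pow _ (hB.map _) fun ρ hρ => ?_
      refine valuation_root_of_all_one O hp hpj hj (by omega) hv k ?_
      have := hmap 1
      rw [← pow_succ'] at this
      rw [← this, ← hAB, Polynomial.map_mul, eval_mul, hρ, mul_zero]
    have h2 : O.valuation β ^ (coincidenceDegree j (n + 1) k - 1) =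
        O.valuation (p : ℂ) ^ B.natDegree := by
      obtain ⟨Q, hQX, hQroot⟩ := valuation_root_of_one_zero O hp hpj hj hv k hN
      rw [← hcoeff 0, ← hdeg 0]
      refine valuation_coeff_zero_pow _ (hB.map _) fun ρ hρ => hQroot ρ ?_
      have h3 := hmap 0
      rw [C_0, sub_zero, hQX, ← hAB, Polynomial.map_mul] at h3
      -- At t = 0 the root b = 0 belongs to A, so B divides the remaining Eisenstein factor.
      have h4 : X ∣ A.map (evalRingHom (0 : ℂ)) := by
        rw [X_dvd_iff, coeff_map, hA']; simp
      obtain ⟨A'', hA''⟩ := h4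
      rw [hA'', mul_assoc] at h3
      rw [← mul_left_cancel₀ X_ne_zero h3, eval_mul, hρ, mul_zero]
    obtain ⟨N, hNe⟩ := Nat.exists_eq_add_of_le hN
    rw [hNe] at h1 h2
    rw [show 2 + N = (2 + N - 1) + 1 by omega, pow_succ, h2] at h1
    have h5 : O.valuation β = 1 := (mul_eq_left₀ (pow_ne_zero _ hvp)).1 h1
    rw [h5, one_pow] at h2
    exact (pow_lt_one₀ zero_le hv hB0).ne h2.symm
  rw [hQ.irreducible_iff_natDegree]
  refine ⟨fun h => ?_, fun A B hA hB hAB => ?_⟩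
  · rw [h, natDegree_one] at hpos
    omega
  · have hX : X ∣ A.coeff 0 * B.coeff 0 := by
      obtain ⟨c, _, hcX⟩ := hc0
      rw [← mul_coeff_zero, hAB, hcX]
      exact dvd_mul_left _ _
    rcases prime_X.dvd_or_dvd hX with h | h
    · by_cases h0 : A.natDegree = 0
      · exact Or.inl h0
      · exact Or.inr (key A B hA hB hAB h h0)
    · by_cases h0 : B.natDegree = 0
      · exact Or.inr h0
      · exact Or.inl (key B A hB hA (by rw [mul_comm, hAB]) h h0)

/-- The coincidence polynomial of the universal polynomial
`z ^ (j + 1) * h z + b` whose free critical points are the variables. -/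
def universalCoincidence (j n k : ℕ) : (MvPolynomial (Fin (n + 1)) ℂ)[X] :=
  coincidence j (n + 1) (cofactor j (n + 1) (∏ i, (X - C (MvPolynomial.X i)))) k

theorem irreducible_universalCoincidence {n : ℕ} (hp : p.Prime) (hpj : p = j + (n + 1) + 1)
    (hj : 1 ≤ j) (k : ℕ) : Irreducible (universalCoincidence j n k) := by
  have hPm : (∏ i : Fin (n + 1), (X - C (MvPolynomial.X i : MvPolynomial (Fin (n + 1)) ℂ))).Monic :=
    monic_prod_of_monic _ _ fun i _ => monic_X_sub_C _
  have hPd : (∏ i : Fin (n + 1),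
      (X - C (MvPolynomial.X i : MvPolynomial (Fin (n + 1)) ℂ))).natDegree = n + 1 := by
    rw [natDegree_prod_of_monic _ _ fun i _ => monic_X_sub_C _]
    simp
  obtain ⟨hQ, _⟩ := monic_coincidence hj (monic_cofactor j hPm hPd) (natDegree_cofactor j hPm hPd) k
  -- Specialization to the line where the first critical point is t and the others are 1.
  let φ : MvPolynomial (Fin (n + 1)) ℂ →ₐ[ℂ] ℂ[X] := MvPolynomial.aeval (Fin.cons X fun _ => 1)
  refine hQ.irreducible_of_irreducible_map (φ : MvPolynomial (Fin (n + 1)) ℂ →+* ℂ[X]) _ ?_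
  rw [map_coincidence, map_cofactor]
  convert irreducible_coincidence_line hp hpj hj k using 3
  rw [Polynomial.map_prod, Fin.prod_univ_succ]
  simp [φ]

end Irreducibility

end

end MarkedCritical

namespace MarkedCritical

open scoped Topology

noncomputable section

/-! ### Zariski open sets and irreducible hypersurfaces. -/

section Zariski

variable {σ : Type}

theorem exists_eval_ne_zero_of_isOpen {U : Set (σ → ℂ)} (hU : IsOpen[zariskiAffine σ] U)
    {x : σ → ℂ} (hx : x ∈ U) : ∃ P : MvPolynomial σ ℂ, MvPolynomial.eval x P ≠ 0 ∧
      ∀ y, MvPolynomial.eval y P ≠ 0 → y ∈ U := by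
  obtain ⟨S, hS⟩ : ∃ S : Set (MvPolynomial σ ℂ), Uᶜ = {x | ∀ P ∈ S, MvPolynomial.eval x P = 0} := hU
  have hx' : x ∉ Uᶜ := fun h => h hx
  rw [hS] at hx'
  simp only [Set.mem_ofPred_eq, not_forall] at hx'
  obtain ⟨P, hP, hPx⟩ := hx'
  refine ⟨P, hPx, fun y hy => ?_⟩
  by_contra hyU
  have hy' : y ∈ Uᶜ := hyU
  rw [hS] at hy'
  exact hy (hy' P hP)

theorem isClosed_zeroSet (S : Set (MvPolynomial σ ℂ)) :
    IsClosed[zariskiAffine σ] {x | ∀ P ∈ S, MvPolynomial.eval x P = 0} := by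
  refine @IsClosed.mk _ (zariskiAffine σ) _ ?_
  change (_ᶜ)ᶜ ∈ _
  rw [compl_compl]
  exact ⟨S, rfl⟩

/-- The nonvanishing loci of two polynomials on a nonempty principal open subset of an irreducible
hypersurface meet, if both are nonempty. -/
theorem exists_common_nonvanishing [Finite σ] {F : MvPolynomial σ ℂ} (hF : Irreducible F)
    {W P Q : MvPolynomial σ ℂ}
    (hP : ∃ y, MvPolynomial.eval y F = 0 ∧ MvPolynomial.eval y W ≠ 0 ∧ MvPolynomial.eval y P ≠ 0)
    (hQ : ∃ y, MvPolynomial.eval y F = 0 ∧ MvPolynomial.eval y Q ≠ 0) :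
    ∃ y, MvPolynomial.eval y F = 0 ∧ MvPolynomial.eval y W ≠ 0 ∧ MvPolynomial.eval y P ≠ 0 ∧
      MvPolynomial.eval y Q ≠ 0 := by
  by_contra hcon
  push Not at hcon
  have hprime : Prime F := hF.prime
  have : (Ideal.span {F}).IsPrime := (Ideal.span_singleton_prime hF.ne_zero).2 hprime
  -- If the loci did not meet, the product would vanish on the hypersurface, so by the
  -- Nullstellensatz the prime F would divide one factor.
  have hvan : W * P * Q ∈ MvPolynomial.vanishingIdeal ℂ
      (MvPolynomial.zeroLocus ℂ (Ideal.span {F})) := by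
    intro y hy
    have hFy : MvPolynomial.eval y F = 0 := hy F (Ideal.subset_span rfl)
    change MvPolynomial.eval y (W * P * Q) = 0
    rw [map_mul, map_mul]
    by_cases hW : MvPolynomial.eval y W = 0
    · simp [hW]
    · by_cases hP : MvPolynomial.eval y P = 0
      · simp [hP]
      · simp [hcon y hFy hW hP]
  rw [MvPolynomial.IsPrime.vanishingIdeal_zeroLocus, Ideal.mem_span_singleton] at hvan
  obtain ⟨y, hy, hyW, hyP⟩ := hP
  obtain ⟨z, hz, hzQ⟩ := hQ
  have hdvd : ∀ {G : MvPolynomial σ ℂ} {w : σ → ℂ}, F ∣ G → MvPolynomial.eval w F = 0 →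
      MvPolynomial.eval w G = 0 := by
    rintro _ w ⟨G, rfl⟩ hw
    rw [map_mul, hw, zero_mul]
  rcases hprime.dvd_or_dvd hvan with h | h
  · rcases hprime.dvd_or_dvd h with h | h
    · exact hyW (hdvd h hy)
    · exact hyP (hdvd h hy)
  · exact hzQ (hdvd h hz)

end Zariski

/-! ### Conjugacy invariance of orbit coincidences and ramification. -/

section Conjugacy

variable {d : ℕ}

theorem mk_mem_setOf_iff {P : MarkedPoly d → Prop}
    (hP : ∀ f g, AffineConj f g → P f → P g) (f : MarkedPoly d) :
    ModuliSpace.mk f ∈ {c | ∃ g : MarkedPoly d, ModuliSpace.mk g = c ∧ P g} ↔ P f :=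
  ⟨fun ⟨g, hg, h⟩ => hP g f (Quotient.exact hg) h, fun h => ⟨f, rfl, h⟩⟩

/-- The `n`-th point of the orbit of the marked critical point. -/
def MarkedPoly.orbit (f : MarkedPoly d) (n : ℕ) : ℂ := (fun z => f.poly.eval z)^[n] f.point

theorem MarkedPoly.orbit_succ (f : MarkedPoly d) (n : ℕ) :
    f.orbit (n + 1) = f.poly.eval (f.orbit n) :=
  Function.iterate_succ_apply' _ _ _

theorem AffineConj.exists_orbit_eq {f g : MarkedPoly d} (h : AffineConj f g) :
    ∃ a b : ℂ, a ≠ 0 ∧ ∀ n, g.orbit n = a * f.orbit n + b := by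
  obtain ⟨a, b, ha, h1, h2⟩ := h
  refine ⟨a, b, ha, fun n => ?_⟩
  induction n with
  | zero => exact h2.symm
  | succ n ih =>
    rw [g.orbit_succ, f.orbit_succ, ih]
    simpa using congrArg (Polynomial.eval (f.orbit n)) h1

theorem AffineConj.orbit_eq_iff {f g : MarkedPoly d} (h : AffineConj f g) (l m : ℕ) :
    g.orbit l = g.orbit m ↔ f.orbit l = f.orbit m := by
  obtain ⟨a, b, ha, ho⟩ := h.exists_orbit_eq
  rw [ho, ho, add_left_inj, mul_right_inj' ha]

theorem isStrictlyPreperiodic_one_iff (f : MarkedPoly d) (k : ℕ) :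
    IsStrictlyPreperiodic (fun z => f.poly.eval z) k 1 f.point ↔
      f.orbit (k + 1) = f.orbit k ∧ ∀ l < k, f.orbit (l + 1) ≠ f.orbit l := by
  refine and_congr Iff.rfl ⟨fun h l hl => h l 1 hl.le le_rfl le_rfl (by simp [hl.ne]), ?_⟩
  intro h l m hl h1 h2 hne
  obtain rfl : m = 1 := le_antisymm h2 h1
  exact h l (lt_of_le_of_ne hl fun e => hne (by rw [e]))

/-- Once two consecutive orbit points agree the orbit is constant, so only the last earlier
coincidence has to be excluded. -/
theorem isStrictlyPreperiodic_succ_one_iff (f : MarkedPoly d) (k : ℕ) :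
    IsStrictlyPreperiodic (fun z => f.poly.eval z) (k + 1) 1 f.point ↔
      f.orbit (k + 2) = f.orbit (k + 1) ∧ f.orbit (k + 1) ≠ f.orbit k := by
  rw [isStrictlyPreperiodic_one_iff]
  refine and_congr Iff.rfl ⟨fun h => h k (Nat.lt_succ_self k), fun h l hl e => h ?_⟩
  have hconst : ∀ i, f.orbit (l + i + 1) = f.orbit (l + i) := fun i => by
    induction i with
    | zero => exact e
    | succ i ih => rw [f.orbit_succ, ← add_assoc, ih, ← f.orbit_succ, ih]
  obtain ⟨i, rfl⟩ := Nat.exists_eq_add_of_le (Nat.lt_succ_iff.1 hl)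
  exact hconst i

theorem AffineConj.isStrictlyPreperiodic_one {f g : MarkedPoly d} (h : AffineConj f g) (k : ℕ)
    (hf : IsStrictlyPreperiodic (fun z => f.poly.eval z) k 1 f.point) :
    IsStrictlyPreperiodic (fun z => g.poly.eval z) k 1 g.point := by
  rw [isStrictlyPreperiodic_one_iff] at hf ⊢
  simpa only [ne_eq, h.orbit_eq_iff] using hf

theorem le_ramificationIndex_iff (hd : d ≠ 0) (f : MarkedPoly d) (r : ℕ) :
    r + 1 ≤ f.ramificationIndex ↔ (X - C f.point) ^ r ∣ f.poly.derivative := by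
  set F := f.poly - C (f.poly.eval f.point) with hF
  have hdeg : F.natDegree = d := by rw [hF, natDegree_sub_C, f.natDegree_eq]
  have hF0 : F ≠ 0 := by
    rintro h
    rw [h, natDegree_zero] at hdeg
    exact hd hdeg.symm
  have hroot : F.IsRoot f.point := by simp [hF, IsRoot]
  have hder : F.derivative = f.poly.derivative := by simp [hF]
  have hder0 : F.derivative ≠ 0 := by
    intro h
    exact hd (hdeg ▸ derivative_eq_zero.1 h)
  have h1 := derivative_rootMultiplicity_of_root hroot
  have h2 : 0 < F.rootMultiplicity f.point := (rootMultiplicity_pos hF0).2 hroot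
  rw [← hder, ← le_rootMultiplicity_iff hder0, h1]
  change r + 1 ≤ F.rootMultiplicity f.point ↔ _
  omega

theorem AffineConj.le_ramificationIndex {f g : MarkedPoly d} (hd : d ≠ 0) (h : AffineConj f g)
    (r : ℕ) (hf : r + 1 ≤ f.ramificationIndex) : r + 1 ≤ g.ramificationIndex := by
  rw [le_ramificationIndex_iff hd] at hf ⊢
  obtain ⟨a, b, ha, h1, h2⟩ := affineConj_symm h
  obtain ⟨q, hq⟩ := hf
  have h3 := congrArg derivative h1
  rw [derivative_comp, hq] at h3
  simp only [derivative_add, derivative_mul, derivative_C, derivative_X, zero_mul, mul_one,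
    zero_add, add_zero, mul_comp, pow_comp, sub_comp, X_comp, C_comp, add_comp] at h3
  have h4 : C a * X + C b - C f.point = C a * (X - C g.point) := by
    rw [← h2, C_add, C_mul]; ring
  rw [h4, mul_pow] at h3
  have hua : IsUnit (C a : ℂ[X]) := isUnit_C.2 (isUnit_iff_ne_zero.2 ha)
  rw [← hua.dvd_mul_left, ← h3]
  exact ⟨C a * (C a ^ r * q.comp (C a * X + C b)), by ring⟩

theorem eq_of_derivative_eq_of_eval_eq {f g : ℂ[X]} (h : f.derivative = g.derivative) (c : ℂ)
    (hc : f.eval c = g.eval c) : f = g := by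
  have h1 : (f - g).natDegree = 0 :=
    derivative_eq_zero.1 (by rw [derivative_sub, h, sub_self])
  have h2 := eq_C_of_natDegree_eq_zero h1
  have h3 := congrArg (Polynomial.eval c) h2
  rw [eval_sub, hc, sub_self, eval_C] at h3
  rw [← h3, C_0] at h2
  exact sub_eq_zero.1 h2

end Conjugacy

/-! ### Polynomial equations for the loci in normal form coordinates. -/

section LocallyClosed

variable {d : ℕ} (hd : 2 < d)

/-- The critical points of the universal polynomial in normal form. -/
def universalAlpha (i : Fin (d - 1)) : MvPolynomial (Option (Fin (d - 2))) ℂ :=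
  if h : (i : ℕ) < d - 2 then MvPolynomial.X (some ⟨i, h⟩)
  else -∑ l : Fin (d - 2), MvPolynomial.X (some l)

theorem eval_universalAlpha (x : Coord d) (i : Fin (d - 1)) :
    MvPolynomial.eval x (universalAlpha i) = x.alpha i := by
  unfold universalAlpha Coord.alpha
  split_ifs <;> simp

theorem Coord.alpha_zero (x : Coord d) : x.alpha ⟨0, by omega⟩ = x.alphaOne hd :=
  dif_pos (by simp only []; omega)

/-- The monic polynomial with roots the critical points of the universal polynomial. -/
def universalCritical (d : ℕ) : (MvPolynomial (Option (Fin (d - 2))) ℂ)[X] :=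
  ∏ i, (X - C (universalAlpha i))

theorem map_universalCritical (x : Coord d) :
    (universalCritical d).map (MvPolynomial.eval x) = ∏ i, (X - C (x.alpha i)) := by
  simp [universalCritical, Polynomial.map_prod, eval_universalAlpha]

/-- The universal polynomial in normal form. -/
def universalNormalForm : (MvPolynomial (Option (Fin (d - 2))) ℂ)[X] :=
  X * cofactor 0 (d - 1) (universalCritical d) -
    C (eval (universalAlpha ⟨0, by omega⟩) (X * cofactor 0 (d - 1) (universalCritical d))) +
    C (MvPolynomial.X none)

theorem map_universalNormalForm (x : Coord d) :
    (universalNormalForm hd).map (MvPolynomial.eval x) = x.normalForm hd := by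
  have hcof := map_cofactor (MvPolynomial.aeval x : MvPolynomial (Option (Fin (d - 2))) ℂ →ₐ[ℂ] ℂ)
    0 (d - 1) (universalCritical d)
  have he : ((MvPolynomial.aeval x : MvPolynomial (Option (Fin (d - 2))) ℂ →ₐ[ℂ] ℂ) :
      MvPolynomial (Option (Fin (d - 2))) ℂ →+* ℂ) = MvPolynomial.eval x := rfl
  rw [he, map_universalCritical] at hcof
  have hmap : (universalNormalForm hd).map (MvPolynomial.eval x) =
      X * cofactor 0 (d - 1) (∏ i, (X - C (x.alpha i))) -
      C (eval (x.alphaOne hd) (X * cofactor 0 (d - 1) (∏ i, (X - C (x.alpha i))))) +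
      C (x none) := by
    rw [universalNormalForm, Polynomial.map_add, Polynomial.map_sub, Polynomial.map_mul, map_X,
      map_C, map_C, ← Polynomial.eval_map_apply, Polynomial.map_mul, map_X, hcof,
      eval_universalAlpha, x.alpha_zero hd, MvPolynomial.eval_X]
  rw [hmap]
  -- Both sides have the same derivative and the value β at α₁, so coefficients in symmetric
  -- functions need not be compared. For j = 0 the cofactor times `X` is the required
  -- antiderivative.
  refine eq_of_derivative_eq_of_eval_eq ?_ (x.alphaOne hd) ?_
  · have hdeg : (∏ i, (X - C (x.alpha i)) : ℂ[X]).natDegree ≤ d - 1 := by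
      rw [natDegree_prod_of_monic _ _ fun i _ => monic_X_sub_C _]
      simp
    have h := derivative_X_pow_mul_cofactor 0 hdeg
    rw [x.derivative_normalForm hd, derivative_add, derivative_sub, derivative_C, derivative_C,
      add_zero, sub_zero]
    rw [zero_add, pow_one, pow_zero, one_mul, zero_add, Nat.sub_add_cancel (by omega)] at h
    exact h
  · simp [Coord.normalForm]

/-- The orbit of the marked critical point of the universal polynomial. -/
def universalOrbit : ℕ → MvPolynomial (Option (Fin (d - 2))) ℂ
  | 0 => universalAlpha ⟨0, by omega⟩
  | n + 1 => (universalNormalForm hd).eval (universalOrbit n)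

theorem eval_universalOrbit (x : Coord d) (n : ℕ) :
    MvPolynomial.eval x (universalOrbit hd n) = (x.markedPoly hd).orbit n := by
  induction n with
  | zero =>
    rw [universalOrbit, eval_universalAlpha, x.alpha_zero hd]
    rfl
  | succ n ih =>
    rw [universalOrbit, MarkedPoly.orbit_succ, ← ih, ← Polynomial.eval_map_apply,
      map_universalNormalForm]
    rfl

theorem isClosed_orbit_eq (l m : ℕ) : IsClosed[zariskiModuli hd]
    {c : ModuliSpace d | ∃ f : MarkedPoly d, ModuliSpace.mk f = c ∧ f.orbit l = f.orbit m} := by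
  rw [@isClosed_coinduced]
  convert isClosed_zeroSet {universalOrbit hd l - universalOrbit hd m} using 1
  ext x
  refine (mk_mem_setOf_iff (fun f g h => (h.orbit_eq_iff l m).2) _).trans ?_
  simp [eval_universalOrbit, sub_eq_zero]

theorem isClosed_ramificationLocus (r : ℕ) :
    IsClosed[zariskiModuli hd] (ramificationLocus d (r + 1)) := by
  rw [@isClosed_coinduced]
  -- Moving α₁ to the origin turns divisibility by (X - α₁)^r into the vanishing of the r lowest
  -- coefficients.
  let T := (universalCritical d).comp (X + C (universalAlpha ⟨0, by omega⟩))
  convert isClosed_zeroSet {P | ∃ i < r, P = T.coeff i} using 1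
  ext x
  refine (mk_mem_setOf_iff (fun f g h => h.le_ramificationIndex (by omega) r) _).trans ?_
  rw [le_ramificationIndex_iff (by omega)]
  change _ ∣ (x.normalForm hd).derivative ↔ _
  have hd0 : IsUnit (C (d : ℂ)) :=
    isUnit_C.2 (isUnit_iff_ne_zero.2 (Nat.cast_ne_zero.2 (by omega)))
  rw [x.derivative_normalForm hd, hd0.dvd_mul_left, X_sub_C_pow_dvd_iff, X_pow_dvd_iff]
  have hT : T.map (MvPolynomial.eval x) =
      (∏ i, (X - C (x.alpha i))).comp (X + C (x.markedPoly hd).point) := by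
    rw [Polynomial.map_comp, map_universalCritical, Polynomial.map_add, map_X, map_C,
      eval_universalAlpha, x.alpha_zero hd]
    rfl
  rw [← hT]
  simp only [coeff_map, Set.mem_ofPred_eq]
  exact ⟨fun h P ⟨i, hi, e⟩ => e ▸ h i hi, fun h i hi => h _ ⟨i, hi, rfl⟩⟩

theorem isLocallyClosed_preperiodicLocus_inter (k r : ℕ) :
    @IsLocallyClosed _ (zariskiModuli hd)
      (preperiodicLocus k 1 d ∩ ramificationLocus d (r + 1)) := by
  let := zariskiModuli hd
  refine ⟨⋂ l ∈ Finset.range k, {c : ModuliSpace d | ∃ f : MarkedPoly d, ModuliSpace.mk f = c ∧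
    f.orbit (l + 1) = f.orbit l}ᶜ, {c : ModuliSpace d | ∃ f : MarkedPoly d, ModuliSpace.mk f = c ∧
    f.orbit (k + 1) = f.orbit k} ∩ ramificationLocus d (r + 1), ?_, ?_, ?_⟩
  · exact isOpen_biInter_finset fun l _ => (isClosed_orbit_eq hd (l + 1) l).isOpen_compl
  · exact (isClosed_orbit_eq hd (k + 1) k).inter (isClosed_ramificationLocus hd r)
  · rw [← Set.inter_assoc]
    congr 1
    ext c
    obtain ⟨f, rfl⟩ : ∃ f, ModuliSpace.mk f = c := Quotient.exists_rep c
    have hinv : ∀ l m : ℕ, ModuliSpace.mk f ∈ {c : ModuliSpace d | ∃ f : MarkedPoly d,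
        ModuliSpace.mk f = c ∧ f.orbit l = f.orbit m} ↔ f.orbit l = f.orbit m := fun l m =>
      mk_mem_setOf_iff (fun f g h => (h.orbit_eq_iff l m).2) f
    refine (mk_mem_setOf_iff (fun f g h => h.isStrictlyPreperiodic_one k) f).trans ?_
    rw [isStrictlyPreperiodic_one_iff, and_comm]
    refine and_congr ?_ (hinv _ _).symm
    rw [Set.mem_iInter₂]
    refine forall_congr' fun l => ?_
    rw [Finset.mem_range]
    exact imp_congr_right fun _ => not_congr (hinv _ _).symm

end LocallyClosed

/-! ### The family z^(j+1) h(z) + b marked at 0. -/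

section CenteredFamily

theorem monic_prod_X_sub_C {R ι : Type*} [CommRing R] [Fintype ι] (γ : ι → R) :
    (∏ i, (X - C (γ i))).Monic :=
  monic_prod_of_monic _ _ fun _ _ => monic_X_sub_C _

theorem natDegree_prod_X_sub_C {R : Type*} [CommRing R] [Nontrivial R] {m : ℕ} (γ : Fin m → R) :
    (∏ i, (X - C (γ i))).natDegree = m := by
  rw [natDegree_prod_of_monic _ _ fun i _ => monic_X_sub_C _]
  simp

/-- The polynomial `z ^ (j + 1) * h z + b` with critical point `0` of multiplicity at
least `j`, other critical points `y (some i)`, and `b = y none`. -/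
def centeredPoly (j n : ℕ) (y : Option (Fin (n + 1)) → ℂ) : ℂ[X] :=
  X ^ (j + 1) * cofactor j (n + 1) (∏ i, (X - C (y (some i)))) + C (y none)

variable (j n : ℕ) (y : Option (Fin (n + 1)) → ℂ)

theorem derivative_centeredPoly : (centeredPoly j n y).derivative =
    C ((j + (n + 1) + 1 : ℕ) : ℂ) * (X ^ j * ∏ i, (X - C (y (some i)))) := by
  rw [centeredPoly, derivative_add, derivative_C, add_zero,
    derivative_X_pow_mul_cofactor j (natDegree_prod_X_sub_C _).le]

theorem eval_zero_centeredPoly : (centeredPoly j n y).eval 0 = y none := by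
  simp [centeredPoly]

variable {j} (hj : 1 ≤ j)

/-- The polynomial `centeredPoly j n y` marked at the critical point `0`. -/
def centeredMarkedPoly : MarkedPoly (j + (n + 1) + 1) where
  poly := centeredPoly j n y
  point := 0
  natDegree_eq := by
    have hm := monic_prod_X_sub_C fun i => y (some i)
    have hd := natDegree_prod_X_sub_C fun i => y (some i)
    rw [centeredPoly, natDegree_add_C, (monic_X_pow _).natDegree_mul (monic_cofactor j hm hd),
      natDegree_cofactor j hm hd, natDegree_X_pow]
    ring
  critical := by
    rw [derivative_centeredPoly]
    simp [show j ≠ 0 by omega]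

theorem centeredMarkedPoly_poly : (centeredMarkedPoly n y hj).poly = centeredPoly j n y := rfl

theorem orbit_centeredMarkedPoly (k : ℕ) : (centeredMarkedPoly n y hj).orbit k =
    y none * (reducedOrbit j (cofactor j (n + 1) (∏ i, (X - C (y (some i))))) k).eval (y none) := by
  induction k with
  | zero => simp [reducedOrbit]; rfl
  | succ k ih =>
    rw [MarkedPoly.orbit_succ, ih]
    change (centeredPoly j n y).eval _ = _
    simp only [centeredPoly, reducedOrbit, eval_add, eval_mul, eval_pow, eval_X, eval_C, eval_one,
      eval_comp]
    ring

theorem eval_bind₁_apply {σ τ : Type} (Q : σ → MvPolynomial τ ℂ) (P : MvPolynomial σ ℂ)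
    (y : τ → ℂ) : MvPolynomial.eval y (MvPolynomial.bind₁ Q P) =
      MvPolynomial.eval (fun s => MvPolynomial.eval y (Q s)) P :=
  MvPolynomial.eval₂Hom_bind₁ _ _ _ _

theorem eval_optionEquivLeft_symm {σ : Type} (F : (MvPolynomial σ ℂ)[X]) (y : Option σ → ℂ) :
    MvPolynomial.eval y ((MvPolynomial.optionEquivLeft ℂ σ).symm F) =
      (F.map (MvPolynomial.eval fun i => y (some i))).eval (y none) := by
  have h := MvPolynomial.optionEquivLeft_elim_eval ℂ σ (fun i => y (some i)) (y none)
    ((MvPolynomial.optionEquivLeft ℂ σ).symm F)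
  rw [AlgEquiv.apply_symm_apply] at h
  rw [← h]
  congr 2
  funext i
  cases i <;> rfl

theorem map_universal_cofactor :
    (cofactor j (n + 1) (∏ i, (X - C (MvPolynomial.X i : MvPolynomial (Fin (n + 1)) ℂ)))).map
      (MvPolynomial.eval fun i => y (some i)) =
      cofactor j (n + 1) (∏ i, (X - C (y (some i)))) := by
  have h := map_cofactor (MvPolynomial.aeval (fun i => y (some i)) :
    MvPolynomial (Fin (n + 1)) ℂ →ₐ[ℂ] ℂ) j (n + 1)
    (∏ i, (X - C (MvPolynomial.X i : MvPolynomial (Fin (n + 1)) ℂ)))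
  have he : ((MvPolynomial.aeval (fun i => y (some i)) : MvPolynomial (Fin (n + 1)) ℂ →ₐ[ℂ] ℂ) :
      MvPolynomial (Fin (n + 1)) ℂ →+* ℂ) = MvPolynomial.eval fun i => y (some i) := rfl
  rw [he] at h
  rw [h]
  simp [Polynomial.map_prod]

/-- In the coordinates `y`, the preperiodic locus is a nonempty principal open subset of an
irreducible hypersurface. -/
theorem exists_irreducible_equation (hp : (j + (n + 1) + 1).Prime) (k : ℕ) :
    ∃ F W : MvPolynomial (Option (Fin (n + 1))) ℂ, Irreducible F ∧
      (∀ y, IsStrictlyPreperiodic (fun z => (centeredMarkedPoly n y hj).poly.eval z) k 1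
        (centeredMarkedPoly n y hj).point ↔
          MvPolynomial.eval y F = 0 ∧ MvPolynomial.eval y W ≠ 0) ∧
      ∃ y, MvPolynomial.eval y F = 0 ∧ MvPolynomial.eval y W ≠ 0 := by
  cases k with
  | zero =>
    refine ⟨MvPolynomial.X none, 1, MvPolynomial.X_prime.irreducible, fun y => ?_, 0, ?_, ?_⟩
    · rw [isStrictlyPreperiodic_one_iff, orbit_centeredMarkedPoly, orbit_centeredMarkedPoly]
      simp [reducedOrbit]
    · simp
    · simp
  | succ k =>
    let e := (MvPolynomial.optionEquivLeft ℂ (Fin (n + 1))).symm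
    let h := cofactor j (n + 1) (∏ i, (X - C (MvPolynomial.X i : MvPolynomial (Fin (n + 1)) ℂ)))
    have hF : ∀ y, MvPolynomial.eval y (e (universalCoincidence j n k)) =
        (coincidence j (n + 1) (cofactor j (n + 1) (∏ i, (X - C (y (some i))))) k).eval
          (y none) := fun y => by
      rw [eval_optionEquivLeft_symm, universalCoincidence, map_coincidence, map_universal_cofactor]
    have hW : ∀ y, MvPolynomial.eval y
        (e (X * (reducedOrbit j h (k + 1) - reducedOrbit j h k))) = y none *
        (reducedOrbit j (cofactor j (n + 1) (∏ i, (X - C (y (some i))))) (k + 1) -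
          reducedOrbit j (cofactor j (n + 1) (∏ i, (X - C (y (some i))))) k).eval (y none) :=
      fun y => by
        rw [eval_optionEquivLeft_symm, Polynomial.map_mul, Polynomial.map_sub, map_reducedOrbit,
          map_reducedOrbit, map_universal_cofactor, map_X, eval_mul, eval_X]
    refine ⟨e (universalCoincidence j n k),
      e (X * (reducedOrbit j h (k + 1) - reducedOrbit j h k)),
      (MulEquiv.irreducible_iff e).2 (irreducible_universalCoincidence hp rfl hj k),
      fun y => ?_, ?_⟩
    · rw [hF, hW, isStrictlyPreperiodic_succ_one_iff]
      simp only [orbit_centeredMarkedPoly]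
      have key := congrArg (Polynomial.eval (y none)) (reducedOrbit_sub_mul_coincidence (j := j)
        (natDegree_cofactor j (monic_prod_X_sub_C fun i => y (some i))
          (natDegree_prod_X_sub_C _)).le k)
      set g := cofactor j (n + 1) (∏ i, (X - C (y (some i))))
      rw [eval_mul, eval_mul, eval_pow, eval_X, eval_sub (p := reducedOrbit j g (k + 2))] at key
      rw [← sub_eq_zero, ← mul_sub, ← key, ne_eq, ← sub_eq_zero (b := y none * _), ← mul_sub,
        ← eval_sub]
      -- Where b (u_{k+1} - u_k) ≠ 0, the extraneous factors of the orbit difference can be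
      -- cancelled.
      refine and_congr_left fun hne => ?_
      obtain ⟨h1, h2⟩ := mul_ne_zero_iff.1 hne
      rw [mul_eq_zero, or_iff_right h1, mul_eq_zero,
        or_iff_right (mul_ne_zero (pow_ne_zero _ h1) h2)]
    · obtain ⟨b, h1, h2, h3⟩ := exists_nondegenerate_root hp rfl hj (Nat.le_add_left 1 n) k
      refine ⟨fun i => i.elim b fun _ => 1, ?_, ?_⟩
      · rw [hF]
        simpa using h1
      · rw [hW]
        simpa [h2] using h3

end CenteredFamily

/-! ### From the centered family to normal form coordinates, and surjectivity. -/

section Coordinates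

theorem alpha_eq_of_sum_eq_zero {N : ℕ} (r : Fin (N + 1) → ℂ) (hr : ∑ i, r i = 0)
    (x : Coord (N + 2)) (hx : ∀ l : Fin N, x (some l) = r l.castSucc) (i : Fin (N + 1)) :
    x.alpha i = r i := by
  induction i using Fin.lastCases with
  | last =>
    rw [Fin.sum_univ_castSucc] at hr
    have h : x.alpha (Fin.last N) = -∑ l : Fin N, x (some l) :=
      dif_neg (show ¬ ((Fin.last N : Fin (N + 1)) : ℕ) < N + 2 - 2 by simp)
    rw [h, Finset.sum_congr rfl fun l _ => hx l]
    exact (eq_neg_of_add_eq_zero_right hr).symm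
  | cast l =>
    rw [← hx]
    exact dif_pos (show ((Fin.castSucc l : Fin (N + 1)) : ℕ) < N + 2 - 2 from l.2)

variable {j : ℕ} (n : ℕ)

/-- The translation that moves the centre of mass of the critical points of `centeredPoly j n y`
to the origin. -/
def centerShift (j : ℕ) {n : ℕ} (y : Option (Fin (n + 1)) → ℂ) : ℂ :=
  -((j + n + 1 : ℂ)⁻¹ * ∑ i, y (some i))

/-- The critical points of the translate of `centeredPoly j n y` in normal form. -/
def shiftedCritical (j : ℕ) {n : ℕ} (y : Option (Fin (n + 1)) → ℂ) : Fin (j + (n + 1)) → ℂ :=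
  Fin.append (fun _ => centerShift j y) fun i => y (some i) + centerShift j y

theorem sum_shiftedCritical (y : Option (Fin (n + 1)) → ℂ) : ∑ i, shiftedCritical j y i = 0 := by
  have h0 : (j + n + 1 : ℂ) ≠ 0 := by exact_mod_cast Nat.succ_ne_zero (j + n)
  rw [Fin.sum_univ_add]
  simp only [shiftedCritical, Fin.append_left, Fin.append_right, Finset.sum_add_distrib,
    Finset.sum_const, Finset.card_univ, Fintype.card_fin, nsmul_eq_mul, centerShift]
  push_cast
  field_simp
  ring

/-- The normal form coordinates of the class of `centeredPoly j n y`. -/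
def normalCoord (j : ℕ) {n : ℕ} (y : Option (Fin (n + 1)) → ℂ) : Coord (j + (n + 1) + 1)
  | none => y none + centerShift j y
  | some i => shiftedCritical j y (Fin.castSucc (n := j + n) i)

theorem alpha_normalCoord (y : Option (Fin (n + 1)) → ℂ) (i : Fin (j + (n + 1))) :
    (normalCoord j y).alpha i = shiftedCritical j y i :=
  alpha_eq_of_sum_eq_zero (N := j + n) _ (sum_shiftedCritical n y) _ (fun _ => rfl) i

/-- Polynomiality of the coordinate change lets Zariski open conditions be pulled back to (γ,
b)-space. -/
theorem exists_eval_eq_normalCoord (s : Option (Fin (j + (n + 1) + 1 - 2))) :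
    ∃ Q : MvPolynomial (Option (Fin (n + 1))) ℂ, ∀ y, MvPolynomial.eval y Q = normalCoord j y s := by
  let c : MvPolynomial (Option (Fin (n + 1))) ℂ :=
    -(MvPolynomial.C (j + n + 1 : ℂ)⁻¹ * ∑ i, MvPolynomial.X (some i))
  have hc : ∀ y, MvPolynomial.eval y c = centerShift j y := fun y => by simp [c, centerShift]
  have hr : ∀ i : Fin (j + (n + 1)), ∃ Q : MvPolynomial (Option (Fin (n + 1))) ℂ,
      ∀ y, MvPolynomial.eval y Q = shiftedCritical j y i := fun i => by
    induction i using Fin.addCases with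
    | left i => exact ⟨c, fun y => by rw [hc, shiftedCritical, Fin.append_left]⟩
    | right i =>
      exact ⟨MvPolynomial.X (some i) + c, fun y => by
        rw [map_add, hc, shiftedCritical, Fin.append_right, MvPolynomial.eval_X]⟩
  cases s with
  | none => exact ⟨MvPolynomial.X none + c, fun y => by rw [map_add, hc, MvPolynomial.eval_X]; rfl⟩
  | some i => exact hr _

variable (hj : 1 ≤ j) (hd : 2 < j + (n + 1) + 1)

theorem alphaOne_normalCoord (hj : 1 ≤ j) (y : Option (Fin (n + 1)) → ℂ) :
    (normalCoord j y).alphaOne hd = centerShift j y := by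
  rw [← Coord.alpha_zero, alpha_normalCoord]
  exact Fin.append_left _ _ (⟨0, hj⟩ : Fin j)

theorem toModuli_normalCoord (hj : 1 ≤ j) (y : Option (Fin (n + 1)) → ℂ) :
    (normalCoord j y).toModuli hd = ModuliSpace.mk (centeredMarkedPoly n y hj) := by
  suffices h : AffineConj (centeredMarkedPoly n y hj) ((normalCoord j y).markedPoly hd) from
    (Quotient.sound h).symm
  refine ⟨1, centerShift j y, one_ne_zero, ?_, ?_⟩
  · change ((normalCoord j y).normalForm hd).comp _ = Polynomial.comp _ (centeredPoly j n y)
    refine eq_of_derivative_eq_of_eval_eq ?_ 0 ?_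
    · rw [derivative_comp, derivative_comp, Coord.derivative_normalForm, derivative_centeredPoly]
      change _ * (C _ * ∏ i : Fin (j + (n + 1)), (X - C (Coord.alpha _ _))).comp _ = _
      simp only [alpha_normalCoord]
      rw [Fin.prod_univ_add]
      simp [shiftedCritical, prod_comp]
    · simp [Coord.normalForm, alphaOne_normalCoord n hd hj, eval_zero_centeredPoly]
      rfl
  · change 1 * (0 : ℂ) + centerShift j y = (normalCoord j y).alphaOne hd
    rw [alphaOne_normalCoord n hd hj, mul_zero, zero_add]

theorem toModuli_normalCoord_mem (y : Option (Fin (n + 1)) → ℂ) :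
    (normalCoord j y).toModuli hd ∈ equalCriticalLocus hd j := by
  refine ⟨_, rfl, fun i hi => ?_⟩
  rw [alphaOne_normalCoord n hd (by omega)]
  change shiftedCritical j y (Fin.castAdd (n + 1) (⟨i, hi⟩ : Fin j)) = _
  exact Fin.append_left _ _ _

theorem equalCriticalLocus_subset :
    equalCriticalLocus hd j ⊆ ramificationLocus (j + (n + 1) + 1) (j + 1) := by
  rintro _ ⟨x, rfl, hx⟩
  refine ⟨x.markedPoly hd, rfl, ?_⟩
  rw [le_ramificationIndex_iff (by omega)]
  change (X - C (x.alphaOne hd)) ^ j ∣ (x.normalForm hd).derivative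
  rw [x.derivative_normalForm hd]
  refine Dvd.dvd.mul_left ?_ _
  change _ ∣ ∏ i : Fin (j + (n + 1)), (X - C (Coord.alpha _ _))
  rw [Fin.prod_univ_add]
  refine Dvd.dvd.mul_right ?_ _
  have h : ∀ i : Fin j, x.alpha (Fin.castAdd (n + 1) i) = x.alphaOne hd := fun i => by
    have hi : (i : ℕ) < j + (n + 1) + 1 - 2 := by omega
    rw [← hx ⟨i, hi⟩ i.2]
    exact dif_pos hi
  rw [Finset.prod_congr rfl fun i _ => by rw [h i]]
  simp

theorem exists_fin_map_eq {α : Type*} {m : ℕ} (s : Multiset α) (hs : Multiset.card s = m) :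
    ∃ r : Fin m → α, Finset.univ.val.map r = s := by
  induction s using Quotient.inductionOn with
  | h l =>
    subst hs
    exact ⟨l.get, (Fin.univ_val_map l.get).trans (congrArg _ (List.ofFn_get l))⟩

/-- Conjugating by z ↦ a (z - c) moves the marked point c to 0; with A the leading coefficient,
a^(p-1) = A makes the result monic. -/
theorem exists_centeredMarkedPoly (f : MarkedPoly (j + (n + 1) + 1))
    (hf : j + 1 ≤ f.ramificationIndex) :
    ∃ y, ModuliSpace.mk (centeredMarkedPoly n y hj) = ModuliSpace.mk f := by
  rw [le_ramificationIndex_iff (by omega)] at hf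
  obtain ⟨q, hq⟩ := hf
  set c := f.point
  set A := f.poly.leadingCoeff
  have hp0 : f.poly ≠ 0 := by
    intro h
    have := f.natDegree_eq
    rw [h, natDegree_zero] at this
    omega
  have hA : A ≠ 0 := leadingCoeff_ne_zero.2 hp0
  have hdeg : f.poly.derivative.natDegree = j + (n + 1) := by
    rw [natDegree_derivative, f.natDegree_eq, Nat.add_sub_cancel]
  have hlead : f.poly.derivative.leadingCoeff = A * ((j + (n + 1) + 1 : ℕ) : ℂ) := by
    rw [leadingCoeff_derivative, f.natDegree_eq]
  have hXc : ((X - C c) ^ j).Monic := (monic_X_sub_C c).pow j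
  have hq0 : q ≠ 0 := by
    rintro rfl
    rw [mul_zero] at hq
    rw [hq, natDegree_zero] at hdeg
    omega
  have hqdeg : q.natDegree = n + 1 := by
    rw [hq, hXc.natDegree_mul' hq0, (monic_X_sub_C c).natDegree_pow, natDegree_X_sub_C] at hdeg
    omega
  have hqlead : q.leadingCoeff = A * ((j + (n + 1) + 1 : ℕ) : ℂ) := by
    rw [← hlead, hq, leadingCoeff_mul, hXc.leadingCoeff, one_mul]
  have hqs : q.Splits := IsAlgClosed.splits q
  obtain ⟨ρ, hρ⟩ := exists_fin_map_eq (m := n + 1) q.roots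
    (by rw [← hqs.natDegree_eq_card_roots, hqdeg])
  have hqprod : q = C (A * ((j + (n + 1) + 1 : ℕ) : ℂ)) * ∏ i, (X - C (ρ i)) := by
    conv_lhs => rw [hqs.eq_prod_roots, hqlead, ← hρ, Multiset.map_map]
    rfl
  obtain ⟨a, ha⟩ := IsAlgClosed.exists_pow_nat_eq A (n := j + (n + 1)) (by omega)
  have ha0 : a ≠ 0 := by
    rintro rfl
    rw [zero_pow (by omega)] at ha
    exact hA ha.symm
  refine ⟨fun s => s.elim (a * (f.poly.eval c - c)) fun i => a * (ρ i - c), ?_⟩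
  suffices h : AffineConj f (centeredMarkedPoly n (fun s => s.elim (a * (f.poly.eval c - c))
      fun i => a * (ρ i - c)) hj) from (Quotient.sound h).symm
  refine ⟨a, -(a * c), ha0, ?_, ?_⟩
  · rw [centeredMarkedPoly_poly]
    refine eq_of_derivative_eq_of_eval_eq ?_ c ?_
    · have h1 : ∀ w : ℂ, C a * X + C (-(a * c)) - C (a * (w - c)) = C a * (X - C w) := fun w => by
        simp only [C_neg, C_mul, C_sub]; ring
      have h2 : C a * X + C (-(a * c)) = C a * (X - C c) := by
        simp only [C_neg, C_mul]; ring
      rw [derivative_comp, derivative_comp, derivative_centeredPoly, hq, hqprod]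
      simp only [Option.elim_some, mul_comp, C_comp, pow_comp, X_comp, prod_comp, sub_comp, h1,
        Finset.prod_mul_distrib, Finset.prod_const, Finset.card_univ, Fintype.card_fin]
      rw [h2]
      simp only [derivative_mul, derivative_C, derivative_X, zero_mul, mul_one,
        zero_add, C_comp, sub_zero, derivative_sub, mul_pow]
      rw [← ha, C_mul, C_pow]
      simp only [map_natCast]
      ring
    · have h3 : a * c + -(a * c) = 0 := by ring
      simp only [eval_comp, eval_add, eval_mul, eval_C, eval_X, h3, eval_zero_centeredPoly,
        Option.elim_none]
      ring
  · change a * c + -(a * c) = 0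
    ring

end Coordinates

end

end MarkedCritical

/-! ### The theorem. -/

open MarkedCritical in
theorem theorem6p1 (p k j : ℕ) (hp : p.Prime) (hp3 : 3 < p) (hj2 : 2 ≤ j) (hj : j ≤ p - 2) :
    letI hd : 2 < p := Nat.lt_of_succ_lt hp3
    letI : TopologicalSpace (MarkedCritical.ModuliSpace p) := MarkedCritical.zariskiModuli hd
    (MarkedCritical.preperiodicLocus k 1 p ∩ MarkedCritical.equalCriticalLocus hd j =
      MarkedCritical.preperiodicLocus k 1 p ∩ MarkedCritical.ramificationLocus p (j + 1)) ∧
    IsLocallyClosed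
      (MarkedCritical.preperiodicLocus k 1 p ∩ MarkedCritical.equalCriticalLocus hd j) ∧
    IsIrreducible
      (MarkedCritical.preperiodicLocus k 1 p ∩ MarkedCritical.equalCriticalLocus hd j) := by
  have hd : 2 < p := Nat.lt_of_succ_lt hp3
  let : TopologicalSpace (ModuliSpace p) := zariskiModuli hd
  -- The number of free critical points is n + 1, positive because j ≤ p - 2.
  obtain ⟨n, rfl⟩ : ∃ n, p = j + (n + 1) + 1 := ⟨p - j - 2, by omega⟩
  have hj1 : 1 ≤ j := by omega
  have hlocus : equalCriticalLocus hd j = ramificationLocus (j + (n + 1) + 1) (j + 1) := by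
    refine (equalCriticalLocus_subset n hd).antisymm ?_
    rintro _ ⟨f, rfl, hf⟩
    obtain ⟨y, hy⟩ := exists_centeredMarkedPoly n hj1 f hf
    rw [← hy, ← toModuli_normalCoord n hd hj1]
    exact toModuli_normalCoord_mem n hd y
  obtain ⟨F, W, hF, hFW, hne⟩ := exists_irreducible_equation n hj1 hp k
  have hmem : ∀ y, MvPolynomial.eval y F = 0 → MvPolynomial.eval y W ≠ 0 →
      (normalCoord j y).toModuli hd ∈ preperiodicLocus k 1 _ ∩ equalCriticalLocus hd j :=
    fun y h1 h2 => ⟨⟨_, (toModuli_normalCoord n hd hj1 y).symm, (hFW y).2 ⟨h1, h2⟩⟩,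
      toModuli_normalCoord_mem n hd y⟩
  have hrange : ∀ c ∈ preperiodicLocus k 1 _ ∩ equalCriticalLocus hd j, ∃ y,
      MvPolynomial.eval y F = 0 ∧ MvPolynomial.eval y W ≠ 0 ∧
        (normalCoord j y).toModuli hd = c := by
    rintro c ⟨hc, hc'⟩
    rw [hlocus] at hc'
    obtain ⟨f, rfl, hf⟩ := hc'
    obtain ⟨y, hy⟩ := exists_centeredMarkedPoly n hj1 f hf
    rw [← hy] at hc ⊢
    have h := (hFW y).1 ((mk_mem_setOf_iff (fun f g h => h.isStrictlyPreperiodic_one k) _).1 hc)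
    exact ⟨y, h.1, h.2, toModuli_normalCoord n hd hj1 y⟩
  choose Q hQ using exists_eval_eq_normalCoord (j := j) n
  have hbind : ∀ (P : MvPolynomial _ ℂ) (y), MvPolynomial.eval y (MvPolynomial.bind₁ Q P) =
      MvPolynomial.eval (normalCoord j y) P := fun P y => by
    rw [eval_bind₁_apply]
    congr 2
    funext s
    exact hQ s y
  refine ⟨by rw [hlocus], ?_, ?_, ?_⟩
  · rw [hlocus]
    exact isLocallyClosed_preperiodicLocus_inter hd k j
  · obtain ⟨y, h1, h2⟩ := hne
    exact ⟨_, hmem y h1 h2⟩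
  -- Points of the locus lift to the hypersurface; polynomials witnessing the two open sets are
  -- pulled back along the coordinate map and have a common nonvanishing point there.
  · rintro U V hU hV ⟨_, hc, hcU⟩ ⟨_, hc', hcV⟩
    obtain ⟨y, hy1, hy2, rfl⟩ := hrange _ hc
    obtain ⟨z, hz1, hz2, rfl⟩ := hrange _ hc'
    obtain ⟨P, hP, hPU⟩ := exists_eval_ne_zero_of_isOpen hU hcU
    obtain ⟨P', hP', hPV⟩ := exists_eval_ne_zero_of_isOpen hV hcV
    obtain ⟨w, hw1, hw2, hw3, hw4⟩ := exists_common_nonvanishing hF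
      (W := W) (P := MvPolynomial.bind₁ Q P) (Q := MvPolynomial.bind₁ Q P')
      ⟨y, hy1, hy2, by rwa [hbind]⟩ ⟨z, hz1, by rwa [hbind]⟩
    rw [hbind] at hw3 hw4
    exact ⟨_, hmem w hw1 hw2, hPU _ hw3, hPV _ hw4⟩
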